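/- **Setting.** Let $V=(1,\dots,d)$ be the ordered node set of a parent graph, that is, of a directed acyclic graph in which an arrow $i\leftarrow k$ is possible only for $i<k$. Its edge matrix $\mathcal A$ is the $d\times d$ matrix with $\mathcal A_{ik}=1$ if $i=k$ or $i\leftarrow k$, and $\mathcal A_{ik}=0$ otherwise. For a real matrix $F$, $\operatorname{In}[F]$ is obtained by changing every non-zero entry into a one, and $F_{ab}$ is the submatrix with rows $a$ and columns $b$. For a subset $a$ of the index set with complement $b$, and $d_a$ the number of elements of $a$, partial inversion and partial closure are $$\operatorname{inv}_aF=\begin{pmatrix}F_{aa}^{-1}&-F_{aa}^{-1}F_{ab}\\F_{ba}F_{aa}^{-1}&F_{bb}-F_{ba}F_{aa}^{-1}F_{ab}\end{pmatrix},\qquad \operatorname{zer}_a\mathcal F=\operatorname{In}\left[\begin{pmatrix}\mathcal F_{aa}^{-}&\mathcal F_{aa}^{-}\mathcal F_{ab}\\\mathcal F_{ba}\mathcal F_{aa}^{-}&\mathcal F_{bb}+\mathcal F_{ba}\mathcal F_{aa}^{-}\mathcal F_{ab}\end{pmatrix}\right],$$ $$\mathcal F_{aa}^{-}=\operatorname{In}[((d_a+1)I_{aa}-\mathcal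 F_{aa})^{-1}].$$ Let $C$ and $M$ be disjoint subsets of $V$ (conditioning and marginalising set). Let $F$ be the set of ancestors of nodes of $C$ that lie outside $C$, $R=C\cup F$, $O=V\setminus R$, $u=O\setminus M$, $v=F\setminus M$, $p=O\setminus u$, $q=F\setminus v$ and $N=u\cup v$. A Gaussian triangular system generated over the parent graph is given by a real unit upper-triangular matrix $A$ with $\operatorname{In}[A]=\mathcal A$ and a diagonal matrix $\Delta$ with positive diagonal, through $AY=\varepsilon$, $\operatorname{cov}(\varepsilon)=\Delta$, so that $\operatorname{cov}(Y)=\Sigma=A^{-1}\Delta A^{-\mathrm T}$. Put $$D=\operatorname{inv}_pA,\qquad \Sigma^{FF.O}=[(\Sigma_{RR})^{-1}]_{F,F},\qquad \operatorname{inv}_q\Sigma^{FF.O}=\begin{pmatrix}\Sigma_{qq|vC}&\Pi_{q|v.C}\\\sim&\Sigma^{vv.uM}\end{pmatrix},$$ $$H_{uu}=D_{uu},\qquad H_{uv}=D_{uv}+D_{uq}\Pi_{q|v.C},\qquad W_{uu}=(\Delta_{uu}+D_{up}\Delta_{pp}D_{up}^{\mathrm T})+D_{uq}\Sigma_{qq|vC}D_{uq}^{\mathrm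 T}.$$ The edge matrices $\mathcal H_{uu},\mathcal H_{uv},\mathcal S^{vv.uM},\mathcal W_{uu}$ of the summary graph $G^{V\setminus[C,M]}_{\mathrm{sum}}$ are the binary matrices of structural zeros of $H_{uu},H_{uv},\Sigma^{vv.uM},W_{uu}$: an entry is $0$ if the corresponding parameter entry vanishes for every Gaussian triangular system generated over the parent graph, and $1$ otherwise. **Corollary 4.** (i) For every Gaussian triangular system generated over the parent graph, these parameters form a Gaussian summary graph model for $Y_{N|C}$: $H_{uu}$ is unit upper-triangular, $W_{uu}$ and $\Sigma^{vv.uM}$ are symmetric positive definite, $\Sigma^{vv.uM}=\Sigma_{vv|C}^{-1}$, and with $H=\begin{pmatrix}H_{uu}&H_{uv}\\0&\Sigma^{vv.uM}\end{pmatrix}$ and $\Sigma_{NN|C}=\Sigma_{NN}-\Sigma_{NC}\Sigma_{CC}^{-1}\Sigma_{CN}$, $$\operatorname{cov}(HY_{N|C})=H\,\Sigma_{NN|C}\,H^{\mathrm T}=\begin{pmatrix}W_{uu}&0\\0&\Sigma^{vv.uM}\end{pmatrix}.$$ (ii) Let $\mathcal D=\operatorname{zer}_p\mathcal A$, let $\mathcal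 S^{FF.O}$ be the $(F,F)$ block of $\operatorname{In}[\mathcal A_{RR}^{\mathrm T}\mathcal A_{RR}]$, and denote the $(q,q)$, $(q,v)$ and $(v,v)$ blocks of $\operatorname{zer}_q\mathcal S^{FF.O}$ by $\mathcal S_{qq|vC}$, $\mathcal P_{q|v.C}$ and $\mathcal S^{vv.qO}$. Then the edge matrices of the summary graph are $$\mathcal H_{uu}=\mathcal D_{uu},\qquad \mathcal H_{uv}=\operatorname{In}[\mathcal D_{uv}+\mathcal D_{uq}\mathcal P_{q|v.C}],\qquad \mathcal S^{vv.uM}=\mathcal S^{vv.qO},$$ $$\mathcal W_{uu}=\operatorname{In}[(I_{uu}+\mathcal D_{up}\mathcal D_{up}^{\mathrm T})+\mathcal D_{uq}\mathcal S_{qq|vC}\mathcal D_{uq}^{\mathrm T}].$$ -/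

import Mathlib

open Matrix

noncomputable section

namespace SummaryGraph

/-! ### Submatrices, indicator matrices, partial inversion and partial closure -/

/-- The submatrix `F_{ab}` of a square matrix `F`. -/
def blk {n : Type*} (F : Matrix n n ℝ) (a b : Finset n) : Matrix a b ℝ :=
  F.submatrix (fun i => (i : n)) (fun j => (j : n))

/-- The inclusion of a node set in a larger one. -/
def incl {n : Type*} {s t : Finset n} (h : s ⊆ t) : s → t := fun x => ⟨x.1, h x.2⟩

open Classical in
/-- `In[F]` changes every non-zero entry of a matrix into a one. -/
def In {m n : Type*} (F : Matrix m n ℝ) : Matrix m n ℝ :=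
  Matrix.of fun i j => if F i j = 0 then 0 else 1

/-- The square matrix whose four blocks, with respect to the split of the index set into `a`
and its complement, are the given ones; the rows and columns stay in their places. -/
def assemble {n : Type*} [Fintype n] [DecidableEq n] (a : Finset n)
    (Faa : Matrix a a ℝ) (Fab : Matrix a (aᶜ : Finset n) ℝ)
    (Fba : Matrix (aᶜ : Finset n) a ℝ) (Fbb : Matrix (aᶜ : Finset n) (aᶜ : Finset n) ℝ) :
    Matrix n n ℝ :=
  Matrix.of fun i j =>
    if hi : i ∈ a then
      if hj : j ∈ a then Faa ⟨i, hi⟩ ⟨j, hj⟩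
      else Fab ⟨i, hi⟩ ⟨j, Finset.mem_compl.2 hj⟩
    else
      if hj : j ∈ a then Fba ⟨i, Finset.mem_compl.2 hi⟩ ⟨j, hj⟩
      else Fbb ⟨i, Finset.mem_compl.2 hi⟩ ⟨j, Finset.mem_compl.2 hj⟩

/-- Partial inversion `inv_a F`. -/
def partialInv {n : Type*} [Fintype n] [DecidableEq n] (a : Finset n) (F : Matrix n n ℝ) :
    Matrix n n ℝ :=
  assemble a
    (blk F a a)⁻¹
    (-((blk F a a)⁻¹ * blk F a aᶜ))
    (blk F aᶜ a * (blk F a a)⁻¹)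
    (blk F aᶜ aᶜ - blk F aᶜ a * (blk F a a)⁻¹ * blk F a aᶜ)

/-- `F_aa^- = In[((d_a + 1) I - F_aa)⁻¹]`, where `d_a` is the number of elements of `a`. -/
def closure {n : Type*} [DecidableEq n] (a : Finset n) (F : Matrix n n ℝ) : Matrix a a ℝ :=
  In ((((a.card : ℝ) + 1) • (1 : Matrix a a ℝ) - blk F a a)⁻¹)

/-- Partial closure `zer_a F` of an edge matrix. -/
def partialClosure {n : Type*} [Fintype n] [DecidableEq n] (a : Finset n) (F : Matrix n n ℝ) :
    Matrix n n ℝ :=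
  In (assemble a
    (closure a F)
    (closure a F * blk F a aᶜ)
    (blk F aᶜ a * closure a F)
    (blk F aᶜ aᶜ + blk F aᶜ a * closure a F * blk F a aᶜ))

/-! ### Parent graphs and the node sets defined by conditioning and marginalising -/

/-- A directed acyclic graph on the ordered node set `V = (1, …, d)`, with a compatible ordering:
`edge i k` means that there is an arrow from `k` to `i`, and then `i < k`.
Connectedness is not required. -/
structure ParentGraph (d : ℕ) where
  edge : Fin d → Fin d → Prop
  lt_of_edge : ∀ i k, edge i k → i < k

namespace ParentGraph

variable {d : ℕ} (G : ParentGraph d) (C M : Finset (Fin d))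

open Classical in
/-- The unit upper-triangular edge matrix of the parent graph. -/
def edgeMatrix : Matrix (Fin d) (Fin d) ℝ :=
  Matrix.of fun i k => if i = k ∨ G.edge i k then 1 else 0

/-- `k` is an ancestor of `i`: there is a path `i ← ⋯ ← k` with at least one arrow. -/
def IsAncestor (k i : Fin d) : Prop := Relation.TransGen G.edge i k

open Classical in
/-- The foster nodes `F` of `C`: the ancestors of `C` outside `C`. -/
def foster : Finset (Fin d) :=
  Finset.univ.filter fun k => k ∉ C ∧ ∃ c ∈ C, G.IsAncestor k c

/-- `R = C ∪ F`. -/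
def right : Finset (Fin d) := C ∪ G.foster C

/-- The outsiders `O = V ∖ R`. -/
def outsiders : Finset (Fin d) := (G.right C)ᶜ

/-- `u = O ∖ M`. -/
def u : Finset (Fin d) := G.outsiders C \ M

/-- `v = F ∖ M`. -/
def v : Finset (Fin d) := G.foster C \ M

/-- `p = O ∖ u`, the outsiders to be marginalised over. -/
def p : Finset (Fin d) := G.outsiders C \ G.u C M

/-- `q = F ∖ v`, the foster nodes to be marginalised over. -/
def q : Finset (Fin d) := G.foster C \ G.v C M

theorem foster_subset_right : G.foster C ⊆ G.right C := Finset.subset_union_right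

theorem q_subset_foster : G.q C M ⊆ G.foster C := Finset.sdiff_subset

theorem v_subset_foster : G.v C M ⊆ G.foster C := Finset.sdiff_subset

/-- The set `q`, as a set of elements of `F`. -/
def qF : Finset (G.foster C) := (G.q C M).subtype (· ∈ G.foster C)

/-! ### Gaussian triangular systems over the parent graph and their parameters -/

/-- `A Y = ε` with `cov ε = diag δ` is a non-degenerate linear triangular system generated over
the parent graph: `A` is unit upper-triangular with exactly the zeros of the edge matrix. -/
structure IsTriangularSystem (A : Matrix (Fin d) (Fin d) ℝ) (δ : Fin d → ℝ) : Prop where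
  diag : ∀ i, A i i = 1
  indicator : In A = G.edgeMatrix
  pos : ∀ i, 0 < δ i

end ParentGraph

/-- The covariance matrix `Σ = A⁻¹ Δ A⁻ᵀ` of `Y` when `A Y = ε`, `cov ε = Δ = diag δ`. -/
def cov {d : ℕ} (A : Matrix (Fin d) (Fin d) ℝ) (δ : Fin d → ℝ) : Matrix (Fin d) (Fin d) ℝ :=
  A⁻¹ * diagonal δ * (A⁻¹)ᵀ

/-- The conditional covariance matrix `Σ_{NN|C}` of `(Y_u, Y_v)` given `Y_C`, that is, the
covariance matrix of the residual `Y_{N|C}`, for `N = (u, v)`. -/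
def condCov {d : ℕ} (S : Matrix (Fin d) (Fin d) ℝ) (u v C : Finset (Fin d)) :
    Matrix (u ⊕ v) (u ⊕ v) ℝ :=
  let f : u ⊕ v → Fin d := Sum.elim (fun i => i.1) (fun i => i.1)
  let g : C → Fin d := fun i => i.1
  S.submatrix f f - S.submatrix f g * (blk S C C)⁻¹ * S.submatrix g f

/-- Gaussian summary graph model for `Y_{N|C}`, `N = (u, v)`, with covariance matrix `S`: the
system `H Y_{N|C} = (η_u, ζ_v)` with `H = ((H_uu, H_uv), (0, K))` is block-triangular and
orthogonal in `(u, v)`, with `cov (η_u, ζ_v) = diag (W_uu, K)`, where `H_uu` is unit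
upper-triangular and `K` is the concentration matrix of `Y_{v|C}`. -/
structure IsGaussianSummaryModel {d : ℕ} {u v : Finset (Fin d)} (S : Matrix (u ⊕ v) (u ⊕ v) ℝ)
    (Huu : Matrix u u ℝ) (Huv : Matrix u v ℝ) (K : Matrix v v ℝ) (Wuu : Matrix u u ℝ) : Prop where
  diag : ∀ i, Huu i i = 1
  upper : ∀ i k : u, k.1 < i.1 → Huu i k = 0
  posDef_W : Wuu.PosDef
  posDef_K : K.PosDef
  concentration : K = (S.toBlocks₂₂)⁻¹
  residual : fromBlocks Huu Huv 0 K * S * (fromBlocks Huu Huv 0 K)ᵀ = fromBlocks Wuu 0 0 K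

namespace ParentGraph

variable {d : ℕ} (G : ParentGraph d) (C M : Finset (Fin d))
  (A : Matrix (Fin d) (Fin d) ℝ) (δ : Fin d → ℝ)

/-- `D = inv_p A`. -/
def paramD : Matrix (Fin d) (Fin d) ℝ := partialInv (G.p C M) A

/-- `Σ^{FF.O}`: the `(F, F)` block of the concentration matrix `Σ^{RR.O} = Σ_RR⁻¹` of `Y_R`. -/
def conFF : Matrix (G.foster C) (G.foster C) ℝ :=
  ((blk (cov A δ) (G.right C) (G.right C))⁻¹).submatrix
    (incl (G.foster_subset_right C)) (incl (G.foster_subset_right C))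

/-- `inv_q Σ^{FF.O}`, with the blocks `Σ_{qq|vC}`, `Π_{q|v.C}` and `Σ^{vv.qO}`. -/
def invConFF : Matrix (G.foster C) (G.foster C) ℝ := partialInv (G.qF C M) (G.conFF C A δ)

/-- `Σ_{qq|vC}`. -/
def sigmaQQ : Matrix (G.q C M) (G.q C M) ℝ :=
  (G.invConFF C M A δ).submatrix (incl (G.q_subset_foster C M)) (incl (G.q_subset_foster C M))

/-- `Π_{q|v.C}`. -/
def piQV : Matrix (G.q C M) (G.v C M) ℝ :=
  (G.invConFF C M A δ).submatrix (incl (G.q_subset_foster C M)) (incl (G.v_subset_foster C M))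

/-- `Σ^{vv.qO} = Σ^{vv.uM}`. -/
def sigmaVV : Matrix (G.v C M) (G.v C M) ℝ :=
  (G.invConFF C M A δ).submatrix (incl (G.v_subset_foster C M)) (incl (G.v_subset_foster C M))

/-- `H_uu = D_uu`. -/
def paramHuu : Matrix (G.u C M) (G.u C M) ℝ := blk (G.paramD C M A) (G.u C M) (G.u C M)

/-- `H_uv = D_uv + D_uq Π_{q|v.C}`. -/
def paramHuv : Matrix (G.u C M) (G.v C M) ℝ :=
  blk (G.paramD C M A) (G.u C M) (G.v C M)
    + blk (G.paramD C M A) (G.u C M) (G.q C M) * G.piQV C M A δ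

/-- `W_uu = (Δ_uu + D_up Δ_pp D_upᵀ) + D_uq Σ_{qq|vC} D_uqᵀ`. -/
def paramWuu : Matrix (G.u C M) (G.u C M) ℝ :=
  (blk (diagonal δ) (G.u C M) (G.u C M)
    + blk (G.paramD C M A) (G.u C M) (G.p C M) * blk (diagonal δ) (G.p C M) (G.p C M)
      * (blk (G.paramD C M A) (G.u C M) (G.p C M))ᵀ)
    + blk (G.paramD C M A) (G.u C M) (G.q C M) * G.sigmaQQ C M A δ
      * (blk (G.paramD C M A) (G.u C M) (G.q C M))ᵀ

/-! ### The summary graph -/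

open Classical in
/-- The edge matrix of structural zeros of a parameter matrix `X`: the entry `(i, k)` is zero if
and only if `X_ik` vanishes for every triangular system generated over the parent graph. -/
def structuralEdgeMatrix {m n : Type*}
    (X : Matrix (Fin d) (Fin d) ℝ → (Fin d → ℝ) → Matrix m n ℝ) : Matrix m n ℝ :=
  Matrix.of fun i k => if ∀ A δ, G.IsTriangularSystem A δ → X A δ i k = 0 then 0 else 1

end ParentGraph

/-- The four edge matrix components of a summary graph in node set `N = (u, v)`: arrows within
`u`, arrows from `v` to `u`, full lines within `v`, dashed lines within `u`. -/
structure SummaryEdgeMatrices {d : ℕ} (u v : Finset (Fin d)) where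
  Huu : Matrix u u ℝ
  Huv : Matrix u v ℝ
  Svv : Matrix v v ℝ
  Wuu : Matrix u u ℝ

namespace ParentGraph

variable {d : ℕ} (G : ParentGraph d) (C M : Finset (Fin d))

/-- The summary graph induced by the parent graph after conditioning on `C` and marginalising
over `M`: its missing edges are the structural zeros of the parameters of the Gaussian summary
graph model. -/
def summaryGraph : SummaryEdgeMatrices (G.u C M) (G.v C M) where
  Huu := G.structuralEdgeMatrix fun A _ => G.paramHuu C M A
  Huv := G.structuralEdgeMatrix fun A δ => G.paramHuv C M A δ
  Svv := G.structuralEdgeMatrix fun A δ => G.sigmaVV C M A δ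
  Wuu := G.structuralEdgeMatrix fun A δ => G.paramWuu C M A δ

/-! ### Edge matrices obtained by partial closure from the edge matrix of the parent graph -/

/-- `zer_p` of the edge matrix of the parent graph. -/
def edgeD : Matrix (Fin d) (Fin d) ℝ := partialClosure (G.p C M) G.edgeMatrix

/-- The edge matrix of the marginal concentration graph of `Y_R` is `In[𝒜_RRᵀ 𝒜_RR]`; this is
its `(F, F)` block. -/
def edgeConFF : Matrix (G.foster C) (G.foster C) ℝ :=
  (In ((blk G.edgeMatrix (G.right C) (G.right C))ᵀ
    * blk G.edgeMatrix (G.right C) (G.right C))).submatrix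
    (incl (G.foster_subset_right C)) (incl (G.foster_subset_right C))

/-- `zer_q` of the edge matrix of the marginal concentration graph on `F`. -/
def zerConFF : Matrix (G.foster C) (G.foster C) ℝ := partialClosure (G.qF C M) (G.edgeConFF C)

/-- The block `(q, q)` of the closed matrix, written `S_{qq|vC}`. -/
def edgeSqq : Matrix (G.q C M) (G.q C M) ℝ :=
  (G.zerConFF C M).submatrix (incl (G.q_subset_foster C M)) (incl (G.q_subset_foster C M))

/-- The block `(q, v)` of the closed matrix, written `P_{q|v.C}`. -/
def edgePqv : Matrix (G.q C M) (G.v C M) ℝ :=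
  (G.zerConFF C M).submatrix (incl (G.q_subset_foster C M)) (incl (G.v_subset_foster C M))

/-- The block `(v, v)` of the closed matrix, written `S^{vv.qO} = S^{vv.uM}`. -/
def edgeSvv : Matrix (G.v C M) (G.v C M) ℝ :=
  (G.zerConFF C M).submatrix (incl (G.v_subset_foster C M)) (incl (G.v_subset_foster C M))

end ParentGraph

end SummaryGraph

end

/-!
The blocks of `D = inv_p A` express residuals of regressions in the triangular system, and
residuals of different regressions are uncorrelated; this gives the block-diagonal covariance.

An entry of a parameter can be non-zero only if the non-negative edge-matrix formula is, because
each inverse occurring in a partial inversion is supported on the transitive closure of its matrix.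
Conversely, take a system whose arrows all have weight of one sign and whose residual variance is
`s⁻¹` on the observed nodes `R ∖ q` and `1` elsewhere. Its parameters are rational functions of `s`
that extend analytically to small negative `s`. There the concentration matrix becomes an
M-matrix, so that no cancellation is possible and every entry allowed by the edge-matrix formula
is non-zero. Being a non-zero analytic function, the entry is also non-zero for some `s > 0`.
-/

noncomputable section

open Topology

namespace SummaryGraph

/-! ### Zero patterns of matrices -/

section Patterns

variable {l m n : Type*}

/-- `X` has its support in that of the entrywise non-negative matrix `F`; for an edge matrix `F`,
every missing edge is a zero of `X`. Non-negativity excludes cancellation, so that the relation is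
compatible with sums and products. -/
structure SupportedOn (X F : Matrix m n ℝ) : Prop where
  nonneg : ∀ i j, 0 ≤ F i j
  eq_zero : ∀ i j, F i j = 0 → X i j = 0

/-- `X` is entrywise non-negative, and positive on the support of `F`; for an edge matrix `F`,
every edge present is a non-zero entry of `X`. -/
structure PosOn (F X : Matrix m n ℝ) : Prop where
  nonneg : ∀ i j, 0 ≤ X i j
  pos : ∀ i j, F i j ≠ 0 → 0 < X i j

theorem In_eq_zero_iff {F : Matrix m n ℝ} {i : m} {j : n} : In F i j = 0 ↔ F i j = 0 := by
  simp [In]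

theorem In_nonneg (F : Matrix m n ℝ) (i : m) (j : n) : 0 ≤ In F i j := by
  simp only [In, of_apply]
  split_ifs <;> norm_num

theorem In_le_one (F : Matrix m n ℝ) (i : m) (j : n) : In F i j ≤ 1 := by
  simp only [In, of_apply]
  split_ifs <;> norm_num

theorem In_In (F : Matrix m n ℝ) : In (In F) = In F := by
  ext i j
  simp [In]

theorem one_apply_nonneg [DecidableEq n] (i j : n) : 0 ≤ (1 : Matrix n n ℝ) i j := by
  rw [one_apply]
  split_ifs <;> norm_num

namespace SupportedOn

variable {X Y F H : Matrix m n ℝ}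

protected theorem In (h : SupportedOn X F) : SupportedOn X (In F) :=
  ⟨In_nonneg F, fun i j hij => h.eq_zero i j (In_eq_zero_iff.1 hij)⟩

theorem add (hX : SupportedOn X F) (hY : SupportedOn Y H) : SupportedOn (X + Y) (F + H) where
  nonneg i j := add_nonneg (hX.nonneg i j) (hY.nonneg i j)
  eq_zero i j hij := by
    obtain ⟨hF, hH⟩ := (add_eq_zero_iff_of_nonneg (hX.nonneg i j) (hY.nonneg i j)).1 hij
    rw [Matrix.add_apply, hX.eq_zero i j hF, hY.eq_zero i j hH, add_zero]

theorem neg (h : SupportedOn X F) : SupportedOn (-X) F :=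
  ⟨h.nonneg, fun i j hij => neg_eq_zero.2 (h.eq_zero i j hij)⟩

theorem sub (hX : SupportedOn X F) (hY : SupportedOn Y H) : SupportedOn (X - Y) (F + H) :=
  sub_eq_add_neg X Y ▸ hX.add hY.neg

theorem mul [Fintype m] {X F : Matrix l m ℝ} {Y H : Matrix m n ℝ} (hX : SupportedOn X F)
    (hY : SupportedOn Y H) : SupportedOn (X * Y) (F * H) where
  nonneg i j := Finset.sum_nonneg fun k _ => mul_nonneg (hX.nonneg i k) (hY.nonneg k j)
  eq_zero i j hij := by
    rw [mul_apply, Finset.sum_eq_zero_iff_of_nonneg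
      fun k _ => mul_nonneg (hX.nonneg i k) (hY.nonneg k j)] at hij
    refine Finset.sum_eq_zero fun k hk => mul_eq_zero.2 ?_
    exact (mul_eq_zero.1 (hij k hk)).imp (hX.eq_zero i k) (hY.eq_zero k j)

theorem transpose (h : SupportedOn X F) : SupportedOn Xᵀ Fᵀ :=
  ⟨fun i j => h.nonneg j i, fun i j => h.eq_zero j i⟩

theorem submatrix (h : SupportedOn X F) {k l : Type*} (f : k → m) (g : l → n) :
    SupportedOn (X.submatrix f g) (F.submatrix f g) :=
  ⟨fun _ _ => h.nonneg _ _, fun _ _ => h.eq_zero _ _⟩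

theorem diagonal [DecidableEq n] (δ : n → ℝ) : SupportedOn (diagonal δ) 1 :=
  ⟨one_apply_nonneg, fun _ j hij => diagonal_apply_ne _ fun h =>
    one_ne_zero ((one_apply_eq j).symm.trans (h ▸ hij))⟩

end SupportedOn

namespace PosOn

variable {X Y F H : Matrix m n ℝ}

theorem of_nonneg (h : ∀ i j, 0 ≤ X i j) : PosOn 0 X := ⟨h, fun _ _ hij => (hij rfl).elim⟩

protected theorem In (h : PosOn F X) : PosOn (In F) X :=
  ⟨h.nonneg, fun i j hij => h.pos i j (mt In_eq_zero_iff.2 hij)⟩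

theorem add (hX : PosOn F X) (hY : PosOn H Y) : PosOn (F + H) (X + Y) where
  nonneg i j := add_nonneg (hX.nonneg i j) (hY.nonneg i j)
  pos i j hij := by
    by_cases hF : F i j = 0
    · have hH : H i j ≠ 0 := fun hH => hij (by rw [Matrix.add_apply, hF, hH, add_zero])
      exact add_pos_of_nonneg_of_pos (hX.nonneg i j) (hY.pos i j hH)
    · exact add_pos_of_pos_of_nonneg (hX.pos i j hF) (hY.nonneg i j)

theorem mul [Fintype m] {F X : Matrix l m ℝ} {H Y : Matrix m n ℝ} (hX : PosOn F X)
    (hY : PosOn H Y) : PosOn (F * H) (X * Y) where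
  nonneg i j := Finset.sum_nonneg fun k _ => mul_nonneg (hX.nonneg i k) (hY.nonneg k j)
  pos i j hij := by
    obtain ⟨k, hk, hne⟩ := Finset.exists_ne_zero_of_sum_ne_zero hij
    exact Finset.sum_pos' (fun k _ => mul_nonneg (hX.nonneg i k) (hY.nonneg k j))
      ⟨k, hk, mul_pos (hX.pos i k (left_ne_zero_of_mul hne))
        (hY.pos k j (right_ne_zero_of_mul hne))⟩

theorem smul (h : PosOn F X) {c : ℝ} (hc : 0 < c) : PosOn F (c • X) :=
  ⟨fun i j => mul_nonneg hc.le (h.nonneg i j), fun i j hij => mul_pos hc (h.pos i j hij)⟩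

theorem transpose (h : PosOn F X) : PosOn Fᵀ Xᵀ :=
  ⟨fun i j => h.nonneg j i, fun i j => h.pos j i⟩

theorem one [DecidableEq n] : PosOn (1 : Matrix n n ℝ) 1 :=
  ⟨one_apply_nonneg, fun i j hij => (one_apply_nonneg i j).lt_of_ne hij.symm⟩

end PosOn

end Patterns

theorem sum_row_le_card {ι : Type*} [Fintype ι] {F : Matrix ι ι ℝ} (h1 : ∀ i j, F i j ≤ 1) (i : ι) :
    ∑ j, F i j ≤ Fintype.card ι := by
  simpa using Finset.sum_le_card_nsmul Finset.univ (F i) 1 fun j _ => h1 i j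

/-! ### M-matrices and closure along walks -/

section MMatrix

variable {ι : Type*} [Fintype ι] [DecidableEq ι]

/-- Non-singular M-matrices: the off-diagonal entries are non-positive and the inverse is
entrywise non-negative. -/
structure IsMMatrix (X : Matrix ι ι ℝ) : Prop where
  isUnit_det : IsUnit X.det
  off_diag_nonpos : ∀ i j, i ≠ j → X i j ≤ 0
  inv_nonneg : ∀ i j, 0 ≤ X⁻¹ i j

theorem IsMMatrix.of_sum_row_pos {X : Matrix ι ι ℝ} (hoff : ∀ i j, i ≠ j → X i j ≤ 0)
    (hrow : ∀ i, 0 < ∑ j, X i j) : IsMMatrix X := by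
  have hdet : IsUnit X.det := by
    refine isUnit_iff_ne_zero.2 (det_ne_zero_of_sum_row_lt_diag fun i => ?_)
    have habs : ∑ j ∈ Finset.univ.erase i, ‖X i j‖ = -∑ j ∈ Finset.univ.erase i, X i j := by
      rw [← Finset.sum_neg_distrib]
      exact Finset.sum_congr rfl fun j hj =>
        Real.norm_of_nonpos (hoff i j (Finset.ne_of_mem_erase hj).symm)
    have hsplit := Finset.add_sum_erase Finset.univ (X i) (Finset.mem_univ i)
    linarith [hrow i, Real.le_norm_self (X i i)]
  refine ⟨hdet, hoff, fun i j => ?_⟩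
  -- In row `i₀` of `X X⁻¹ = 1`, a negative minimum of a column of `X⁻¹` would be multiplied by
  -- the positive row sum.
  obtain ⟨i₀, -, hmin⟩ := Finset.exists_min_image Finset.univ (fun i => X⁻¹ i j)
    ⟨i, Finset.mem_univ i⟩
  refine le_trans (le_of_not_gt fun hneg => ?_) (hmin i (Finset.mem_univ i))
  have hone : (1 : Matrix ι ι ℝ) i₀ j < 0 := by
    calc (1 : Matrix ι ι ℝ) i₀ j = ∑ k, X i₀ k * X⁻¹ k j := by
          rw [← mul_nonsing_inv X hdet, mul_apply]
      _ ≤ ∑ k, X i₀ k * X⁻¹ i₀ j := Finset.sum_le_sum fun k _ => by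
          obtain rfl | hk := eq_or_ne i₀ k
          · exact le_rfl
          · exact mul_le_mul_of_nonpos_left (hmin k (Finset.mem_univ k)) (hoff i₀ k hk)
      _ = (∑ k, X i₀ k) * X⁻¹ i₀ j := (Finset.sum_mul ..).symm
      _ < 0 := mul_neg_of_pos_of_neg (hrow i₀) hneg
  exact absurd (one_apply_nonneg i₀ j) (not_le.2 hone)

theorem IsMMatrix.one_apply_le_diag_mul_inv {X : Matrix ι ι ℝ} (hX : IsMMatrix X) (i j : ι) :
    (1 : Matrix ι ι ℝ) i j ≤ X i i * X⁻¹ i j := by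
  rw [← mul_nonsing_inv X hX.isUnit_det, mul_apply,
    ← Finset.add_sum_erase _ _ (Finset.mem_univ i)]
  exact add_le_of_nonpos_right (Finset.sum_nonpos fun k hk => mul_nonpos_of_nonpos_of_nonneg
    (hX.off_diag_nonpos i k (Finset.ne_of_mem_erase hk).symm) (hX.inv_nonneg k j))

theorem IsMMatrix.diag_pos {X : Matrix ι ι ℝ} (hX : IsMMatrix X) (i : ι) : 0 < X i i := by
  have h : 0 < X i i * X⁻¹ i i :=
    one_pos.trans_le (by simpa using hX.one_apply_le_diag_mul_inv i i)
  exact pos_of_mul_pos_left h (hX.inv_nonneg i i)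

theorem IsMMatrix.inv_pos_of_reflTransGen {X : Matrix ι ι ℝ} (hX : IsMMatrix X) {i j : ι}
    (hij : Relation.ReflTransGen (fun i j => X i j ≠ 0) i j) : 0 < X⁻¹ i j := by
  induction hij using Relation.ReflTransGen.head_induction_on with
  | refl =>
    refine pos_of_mul_pos_right ?_ (hX.diag_pos j).le
    exact one_pos.trans_le (by simpa using hX.one_apply_le_diag_mul_inv j j)
  | @head i k hik _ ih =>
    obtain rfl | hne := eq_or_ne i k
    · exact ih
    have hrow : X i i * X⁻¹ i j + ∑ l ∈ Finset.univ.erase i, X i l * X⁻¹ l j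
        = (1 : Matrix ι ι ℝ) i j := by
      rw [← mul_nonsing_inv X hX.isUnit_det, mul_apply,
        Finset.add_sum_erase _ (fun l => X i l * X⁻¹ l j) (Finset.mem_univ i)]
    have hsum : ∑ l ∈ Finset.univ.erase i, X i l * X⁻¹ l j < 0 :=
      Finset.sum_neg' (fun l hl => mul_nonpos_of_nonpos_of_nonneg
          (hX.off_diag_nonpos i l (Finset.ne_of_mem_erase hl).symm) (hX.inv_nonneg l j))
        ⟨k, Finset.mem_erase.2 ⟨hne.symm, Finset.mem_univ k⟩,
          mul_neg_of_neg_of_pos ((hX.off_diag_nonpos i k hne).lt_of_ne hik) ih⟩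
    refine pos_of_mul_pos_right ?_ (hX.diag_pos i).le
    linarith [one_apply_nonneg i j]

/-- The closure `F⁻ = In[((d + 1) I - F)⁻¹]` of an edge matrix of size `d` on an arbitrary finite
node set; its ones are the pairs joined by a walk. -/
def walkClosure (F : Matrix ι ι ℝ) : Matrix ι ι ℝ :=
  In (((Fintype.card ι : ℝ) + 1) • (1 : Matrix ι ι ℝ) - F)⁻¹

theorem closure_eq_walkClosure {n : Type*} [DecidableEq n] (a : Finset n) (F : Matrix n n ℝ) :
    closure a F = walkClosure (blk F a a) := by
  rw [closure, walkClosure, Fintype.card_coe]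

theorem isMMatrix_smul_one_sub {F : Matrix ι ι ℝ} {c : ℝ} (h0 : ∀ i j, 0 ≤ F i j)
    (hc : ∀ i, ∑ j, F i j < c) : IsMMatrix (c • (1 : Matrix ι ι ℝ) - F) := by
  refine .of_sum_row_pos (fun i j hij => by simp [one_apply_ne hij, h0]) fun i => ?_
  simp only [Matrix.sub_apply, Matrix.smul_apply, one_apply, smul_eq_mul, mul_ite, mul_one,
    mul_zero, Finset.sum_sub_distrib, Finset.sum_ite_eq, Finset.mem_univ, if_true]
  exact sub_pos.2 (hc i)

/-- With respect to the nodes from which `j` can be reached, `X` is block-triangular. -/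
theorem reflTransGen_of_inv_ne_zero {X : Matrix ι ι ℝ} {i j : ι} (hij : X⁻¹ i j ≠ 0) :
    Relation.ReflTransGen (fun i j => X i j ≠ 0) i j := by
  classical
  have hX : IsUnit X.det := by
    by_contra hX
    exact hij (nonsing_inv_apply_not_isUnit X hX ▸ rfl)
  let := invertibleOfIsUnitDet X hX
  let b : ι → ℕ := fun x => if Relation.ReflTransGen (fun i j => X i j ≠ 0) x j then 0 else 1
  have hb : X.BlockTriangular b := by
    intro x y hxy
    by_contra hne
    by_cases hy : Relation.ReflTransGen (fun i j => X i j ≠ 0) y j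
    · simp [b, hy, hy.head hne] at hxy
    · simp only [b, hy, if_false] at hxy
      split_ifs at hxy <;> omega
  by_contra hnot
  refine hij (blockTriangular_inv_of_blockTriangular hb ?_)
  simp [b, hnot, Relation.ReflTransGen.refl]

theorem walkClosure_ne_zero_iff {F : Matrix ι ι ℝ} (h0 : ∀ i j, 0 ≤ F i j)
    (h1 : ∀ i j, F i j ≤ 1) {i j : ι} :
    walkClosure F i j ≠ 0 ↔ Relation.ReflTransGen (fun i j => F i j ≠ 0) i j := by
  rw [walkClosure, Ne, In_eq_zero_iff]
  constructor
  · intro h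
    refine (reflTransGen_of_inv_ne_zero h).lift' id fun x y hxy => ?_
    obtain rfl | hne := eq_or_ne x y
    · exact .refl
    · exact .single (by simpa [one_apply_ne hne] using hxy)
  · intro h
    have hM := isMMatrix_smul_one_sub h0 fun i =>
      (sum_row_le_card h1 i).trans_lt (lt_add_one (Fintype.card ι : ℝ))
    refine (hM.inv_pos_of_reflTransGen (h.lift' id fun x y hxy => ?_)).ne'
    obtain rfl | hne := eq_or_ne x y
    · exact .refl
    · exact .single (by simpa [one_apply_ne hne] using hxy)

theorem SupportedOn.inv {X F : Matrix ι ι ℝ} (h : SupportedOn X F) (h1 : ∀ i j, F i j ≤ 1) :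
    SupportedOn X⁻¹ (walkClosure F) where
  nonneg := In_nonneg _
  eq_zero i j := by
    contrapose!
    intro hij
    exact (walkClosure_ne_zero_iff h.nonneg h1).2
      ((reflTransGen_of_inv_ne_zero hij).lift id fun x y => mt (h.eq_zero x y))

theorem IsMMatrix.posOn_one_inv {X : Matrix ι ι ℝ} (hX : IsMMatrix X) : PosOn 1 X⁻¹ where
  nonneg := hX.inv_nonneg
  pos i j hij := by
    obtain rfl : i = j := by_contra fun h => hij (one_apply_ne h)
    exact hX.inv_pos_of_reflTransGen .refl

theorem IsMMatrix.posOn_inv {X F : Matrix ι ι ℝ} (hX : IsMMatrix X) (h0 : ∀ i j, 0 ≤ F i j)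
    (h1 : ∀ i j, F i j ≤ 1) (h : ∀ i j, i ≠ j → F i j ≠ 0 → X i j ≠ 0) :
    PosOn (walkClosure F) X⁻¹ where
  nonneg := hX.inv_nonneg
  pos i j hij := by
    refine hX.inv_pos_of_reflTransGen
      (((walkClosure_ne_zero_iff h0 h1).1 hij).lift' id fun x y hxy => ?_)
    obtain rfl | hne := eq_or_ne x y
    · exact .refl
    · exact .single (h x y hne hxy)

end MMatrix

/-! ### Partial inversion and partial closure in blocks -/

section Blocks

section Reindex

variable {n ι : Type*} [DecidableEq n] [Fintype ι] [DecidableEq ι] {a : Finset n}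

theorem inv_blk_submatrix_equiv (X : Matrix n n ℝ) (e : ι ≃ a) :
    (blk X a a)⁻¹.submatrix e e
      = (X.submatrix (fun i => (e i : n)) (fun i => (e i : n)))⁻¹ :=
  (inv_submatrix_equiv (blk X a a) e e).symm

theorem closure_submatrix_equiv (F : Matrix n n ℝ) (e : ι ≃ a) :
    (closure a F).submatrix e e
      = walkClosure (F.submatrix (fun i => (e i : n)) (fun i => (e i : n))) := by
  rw [closure_eq_walkClosure, walkClosure, walkClosure, Fintype.card_congr e]
  have hshift : (((Fintype.card a : ℝ) + 1) • (1 : Matrix a a ℝ) - blk F a a).submatrix e e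
      = ((Fintype.card a : ℝ) + 1) • (1 : Matrix ι ι ℝ)
        - F.submatrix (fun i => (e i : n)) (fun i => (e i : n)) := by
    rw [submatrix_sub, submatrix_smul]
    simp only [Pi.sub_apply, Pi.smul_apply, submatrix_one_equiv]
    rfl
  rw [← hshift, inv_submatrix_equiv]
  rfl

end Reindex

variable {n ι κ : Type*} [Fintype n] [DecidableEq n]

section Assemble

variable {a : Finset n} {P P' : Matrix a a ℝ} {Q Q' : Matrix a (aᶜ : Finset n) ℝ}
  {R R' : Matrix (aᶜ : Finset n) a ℝ} {S S' : Matrix (aᶜ : Finset n) (aᶜ : Finset n) ℝ}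

theorem assemble_submatrix₁₁ (e : ι → a) (f : κ → a) :
    (assemble a P Q R S).submatrix (fun i => (e i : n)) (fun k => (f k : n))
      = P.submatrix e f := by
  ext i k
  simp [assemble]

theorem assemble_submatrix₁₂ (e : ι → a) (f : κ → (aᶜ : Finset n)) :
    (assemble a P Q R S).submatrix (fun i => (e i : n)) (fun k => (f k : n))
      = Q.submatrix e f := by
  ext i k
  simp [assemble, Finset.mem_compl.1 (f k).2]

theorem assemble_submatrix₂₁ (e : ι → (aᶜ : Finset n)) (f : κ → a) :
    (assemble a P Q R S).submatrix (fun i => (e i : n)) (fun k => (f k : n))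
      = R.submatrix e f := by
  ext i k
  simp [assemble, Finset.mem_compl.1 (e i).2]

theorem assemble_submatrix₂₂ (e : ι → (aᶜ : Finset n)) (f : κ → (aᶜ : Finset n)) :
    (assemble a P Q R S).submatrix (fun i => (e i : n)) (fun k => (f k : n))
      = S.submatrix e f := by
  ext i k
  simp [assemble, Finset.mem_compl.1 (e i).2, Finset.mem_compl.1 (f k).2]

theorem SupportedOn.assemble (hP : SupportedOn P P') (hQ : SupportedOn Q Q')
    (hR : SupportedOn R R') (hS : SupportedOn S S') :
    SupportedOn (assemble a P Q R S) (SummaryGraph.assemble a P' Q' R' S') := by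
  constructor <;> intro i j <;> simp only [SummaryGraph.assemble, of_apply] <;> split_ifs
  exacts [hP.nonneg _ _, hQ.nonneg _ _, hR.nonneg _ _, hS.nonneg _ _,
    hP.eq_zero _ _, hQ.eq_zero _ _, hR.eq_zero _ _, hS.eq_zero _ _]

end Assemble

theorem SupportedOn.partialInv {X F : Matrix n n ℝ} (a : Finset n) (h : SupportedOn X F)
    (h1 : ∀ i j, F i j ≤ 1) : SupportedOn (partialInv a X) (partialClosure a F) := by
  have hinv : SupportedOn (blk X a a)⁻¹ (closure a F) := by
    rw [closure_eq_walkClosure]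
    exact (h.submatrix _ _).inv fun _ _ => h1 _ _
  exact (SupportedOn.assemble hinv (hinv.mul (h.submatrix _ _)).neg
    ((h.submatrix _ _).mul hinv)
    ((h.submatrix _ _).sub (((h.submatrix _ _).mul hinv).mul (h.submatrix _ _)))).In

variable [Fintype ι] [DecidableEq ι] {a : Finset n} (e : ι ≃ a)

section PartialInv

variable (X : Matrix n n ℝ)

theorem partialInv_submatrix₁₁ :
    (partialInv a X).submatrix (fun i => (e i : n)) (fun i => (e i : n))
      = (X.submatrix (fun i => (e i : n)) (fun i => (e i : n)))⁻¹ := by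
  rw [partialInv, assemble_submatrix₁₁, inv_blk_submatrix_equiv]

theorem partialInv_submatrix₁₂ {f : κ → n} (hf : ∀ k, f k ∉ a) :
    (partialInv a X).submatrix (fun i => (e i : n)) f
      = -((X.submatrix (fun i => (e i : n)) (fun i => (e i : n)))⁻¹
          * X.submatrix (fun i => (e i : n)) f) := by
  rw [← inv_blk_submatrix_equiv, partialInv]
  exact (assemble_submatrix₁₂ e fun k => ⟨f k, Finset.mem_compl.2 (hf k)⟩).trans
    (congrArg Neg.neg (submatrix_mul_equiv _ _ e e _).symm)

theorem partialInv_submatrix₂₁ {f : κ → n} (hf : ∀ k, f k ∉ a) :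
    (partialInv a X).submatrix f (fun i => (e i : n))
      = X.submatrix f (fun i => (e i : n))
          * (X.submatrix (fun i => (e i : n)) (fun i => (e i : n)))⁻¹ := by
  rw [← inv_blk_submatrix_equiv, partialInv]
  exact (assemble_submatrix₂₁ (fun k => ⟨f k, Finset.mem_compl.2 (hf k)⟩) e).trans
    (submatrix_mul_equiv _ _ _ e e).symm

theorem partialInv_submatrix₂₂ {l : Type*} {f : κ → n} {g : l → n} (hf : ∀ k, f k ∉ a)
    (hg : ∀ k, g k ∉ a) :
    (partialInv a X).submatrix f g
      = X.submatrix f g - X.submatrix f (fun i => (e i : n))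
          * (X.submatrix (fun i => (e i : n)) (fun i => (e i : n)))⁻¹
          * X.submatrix (fun i => (e i : n)) g := by
  rw [← inv_blk_submatrix_equiv, partialInv]
  refine (assemble_submatrix₂₂ (fun k => ⟨f k, Finset.mem_compl.2 (hf k)⟩)
    fun k => ⟨g k, Finset.mem_compl.2 (hg k)⟩).trans ?_
  simp only [submatrix_sub, Pi.sub_apply]
  rw [← submatrix_mul_equiv _ _ _ e, ← submatrix_mul_equiv _ _ _ e]
  rfl

end PartialInv

section PartialClosure

variable (F : Matrix n n ℝ)

theorem partialClosure_submatrix₁₁ :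
    (partialClosure a F).submatrix (fun i => (e i : n)) (fun i => (e i : n))
      = In (walkClosure (F.submatrix (fun i => (e i : n)) (fun i => (e i : n)))) := by
  rw [← closure_submatrix_equiv]
  exact congrArg In (assemble_submatrix₁₁ e e)

theorem partialClosure_submatrix₁₂ {f : κ → n} (hf : ∀ k, f k ∉ a) :
    (partialClosure a F).submatrix (fun i => (e i : n)) f
      = In (walkClosure (F.submatrix (fun i => (e i : n)) (fun i => (e i : n)))
          * F.submatrix (fun i => (e i : n)) f) := by
  rw [← closure_submatrix_equiv]
  exact congrArg In ((assemble_submatrix₁₂ e fun k => ⟨f k, Finset.mem_compl.2 (hf k)⟩).trans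
    (submatrix_mul_equiv _ _ e e _).symm)

theorem partialClosure_submatrix₂₁ {f : κ → n} (hf : ∀ k, f k ∉ a) :
    (partialClosure a F).submatrix f (fun i => (e i : n))
      = In (F.submatrix f (fun i => (e i : n))
          * walkClosure (F.submatrix (fun i => (e i : n)) (fun i => (e i : n)))) := by
  rw [← closure_submatrix_equiv]
  exact congrArg In ((assemble_submatrix₂₁ (fun k => ⟨f k, Finset.mem_compl.2 (hf k)⟩) e).trans
    (submatrix_mul_equiv _ _ _ e e).symm)

theorem partialClosure_submatrix₂₂ {l : Type*} {f : κ → n} {g : l → n} (hf : ∀ k, f k ∉ a)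
    (hg : ∀ k, g k ∉ a) :
    (partialClosure a F).submatrix f g
      = In (F.submatrix f g + F.submatrix f (fun i => (e i : n))
          * walkClosure (F.submatrix (fun i => (e i : n)) (fun i => (e i : n)))
          * F.submatrix (fun i => (e i : n)) g) := by
  rw [← closure_submatrix_equiv]
  refine congrArg In ((assemble_submatrix₂₂ (fun k => ⟨f k, Finset.mem_compl.2 (hf k)⟩)
    fun k => ⟨g k, Finset.mem_compl.2 (hg k)⟩).trans ?_)
  simp only [submatrix_add, Pi.add_apply]
  rw [← submatrix_mul_equiv _ _ _ e, ← submatrix_mul_equiv _ _ _ e]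
  rfl

end PartialClosure

end Blocks

/-! ### Residual covariance matrices -/

section Residual

variable {n : Type*}

section Complementary

variable {ι κ : Type*} [Fintype ι] [Fintype κ] [Fintype n]

theorem submatrix_mul_add_submatrix_mul {l m l' m' : Type*} {e : ι → n} {f : κ → n}
    (h : Function.Bijective (Sum.elim e f)) (X : Matrix l n ℝ) (Y : Matrix n m ℝ)
    (r : l' → l) (s : m' → m) :
    X.submatrix r e * Y.submatrix e s + X.submatrix r f * Y.submatrix f s
      = (X * Y).submatrix r s := by
  ext i j
  simpa [mul_apply] using (Equiv.ofBijective _ h).sum_comp fun k => X (r i) k * Y k (s j)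

theorem inv_submatrix_mul_schur [DecidableEq ι] [DecidableEq κ] [DecidableEq n] {e : ι → n}
    {f : κ → n} (h : Function.Bijective (Sum.elim e f)) {S : Matrix n n ℝ} (hS : IsUnit S.det)
    (hSe : IsUnit (S.submatrix e e).det) :
    S⁻¹.submatrix f f
      * (S.submatrix f f - S.submatrix f e * (S.submatrix e e)⁻¹ * S.submatrix e f) = 1 := by
  have hfe : S⁻¹.submatrix f f * S.submatrix f e = -(S⁻¹.submatrix f e * S.submatrix e e) := by
    rw [eq_neg_iff_add_eq_zero, add_comm, submatrix_mul_add_submatrix_mul h, nonsing_inv_mul _ hS]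
    ext i j
    exact one_apply_ne fun hij => Sum.inr_ne_inl (h.1 (a₁ := .inr i) (a₂ := .inl j) hij)
  have hff : S⁻¹.submatrix f e * S.submatrix e f + S⁻¹.submatrix f f * S.submatrix f f = 1 := by
    rw [submatrix_mul_add_submatrix_mul h, nonsing_inv_mul _ hS]
    exact submatrix_one _ fun i j hij => Sum.inr_injective (h.1 (a₁ := .inr i) (a₂ := .inr j) hij)
  rw [Matrix.mul_sub, ← Matrix.mul_assoc, ← Matrix.mul_assoc, hfe, Matrix.neg_mul,
    mul_nonsing_inv_cancel_right _ _ hSe, Matrix.neg_mul, sub_neg_eq_add, add_comm, hff]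

end Complementary

theorem mul_mul_transpose_eq_of_mul_eq {m : Type*} [Fintype n] {S : Matrix n n ℝ}
    {X Y : Matrix m n ℝ} (hS : S.IsSymm) (h : X * S = Y * S) :
    X * S * Xᵀ = Y * S * Yᵀ := by
  have hT : S * Xᵀ = S * Yᵀ := by simpa [hS.eq] using congrArg transpose h
  rw [h, Matrix.mul_assoc, hT, Matrix.mul_assoc]

/-- The covariance matrix of the residual `Y_{V|C}`: `Σ - Σ_{VC} Σ_CC⁻¹ Σ_{CV}`. -/
def residualCov [DecidableEq n] (S : Matrix n n ℝ) (C : Finset n) : Matrix n n ℝ :=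
  S - S.submatrix id (fun i : C => (i : n)) * (blk S C C)⁻¹ * S.submatrix (fun i : C => (i : n)) id

variable [DecidableEq n] {S : Matrix n n ℝ} {C : Finset n}

theorem residualCov_apply_eq_zero (hS : IsUnit (blk S C C).det) {i : n} (hi : i ∈ C) (j : n) :
    residualCov S C i j = 0 := by
  have h : S.submatrix (fun i : C => (i : n)) id = blk S C C * (blk S C C)⁻¹
      * S.submatrix (fun i : C => (i : n)) id := by
    rw [mul_nonsing_inv _ hS, Matrix.one_mul]
  exact sub_eq_zero.2 (congrFun₂ h ⟨i, hi⟩ j)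

theorem isSymm_residualCov (hS : S.IsSymm) : (residualCov S C).IsSymm := by
  have hC : ((blk S C C)⁻¹)ᵀ = (blk S C C)⁻¹ := by
    rw [transpose_nonsing_inv, blk, transpose_submatrix, hS]
  rw [IsSymm, residualCov, transpose_sub, transpose_mul, transpose_mul, transpose_submatrix,
    transpose_submatrix, hS, hC, Matrix.mul_assoc]

end Residual

/-! ### Node sets -/

section SumElim

variable {n : Type*} {r s t : Finset n}

theorem injective_incl (h : s ⊆ r) : Function.Injective (incl h) := fun _ _ hxy =>
  Subtype.ext (congrArg (fun z : r => (z : n)) hxy)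

theorem bijective_sumElim_incl [DecidableEq n] (hs : s ⊆ r) (ht : t ⊆ r) (hd : Disjoint s t)
    (hr : r ⊆ s ∪ t) : Function.Bijective (Sum.elim (incl hs) (incl ht)) := by
  refine ⟨(injective_incl hs).sumElim (injective_incl ht) fun x y hxy => ?_, fun x => ?_⟩
  · exact Finset.disjoint_left.1 hd x.2 ((congrArg (fun z : r => (z : n)) hxy : x.1 = y.1) ▸ y.2)
  · obtain hx | hx := Finset.mem_union.1 (hr x.2)
    · exact ⟨.inl ⟨x, hx⟩, rfl⟩
    · exact ⟨.inr ⟨x, hx⟩, rfl⟩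

theorem bijective_sumElim_val_compl [Fintype n] [DecidableEq n] (s : Finset n) :
    Function.Bijective (Sum.elim (fun x : s => (x : n)) fun x : (sᶜ : Finset n) => (x : n)) := by
  refine ⟨Subtype.val_injective.sumElim Subtype.val_injective fun x y hxy => ?_, fun x => ?_⟩
  · exact Finset.mem_compl.1 y.2 (hxy ▸ x.2)
  · by_cases hx : x ∈ s
    · exact ⟨.inl ⟨x, hx⟩, rfl⟩
    · exact ⟨.inr ⟨x, Finset.mem_compl.2 hx⟩, rfl⟩

end SumElim

namespace ParentGraph

variable {d : ℕ} (G : ParentGraph d) {C M : Finset (Fin d)} {i k : Fin d}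

theorem edgeMatrix_ne_zero_iff : G.edgeMatrix i k ≠ 0 ↔ i = k ∨ G.edge i k := by
  simp [edgeMatrix, or_iff_not_imp_left]

theorem edgeMatrix_nonneg (i k : Fin d) : 0 ≤ G.edgeMatrix i k := by
  simp only [edgeMatrix, of_apply]
  split_ifs <;> norm_num

theorem edgeMatrix_le_one (i k : Fin d) : G.edgeMatrix i k ≤ 1 := by
  simp only [edgeMatrix, of_apply]
  split_ifs <;> norm_num

theorem mem_foster_iff : i ∈ G.foster C ↔ i ∉ C ∧ ∃ c ∈ C, G.IsAncestor i c := by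
  simp [foster]

theorem mem_right_of_edge (hi : i ∈ G.right C) (h : G.edge i k) : k ∈ G.right C := by
  by_cases hk : k ∈ C
  · exact Finset.mem_union_left _ hk
  refine Finset.mem_union_right _ (G.mem_foster_iff.2 ⟨hk, ?_⟩)
  obtain hi | hi := Finset.mem_union.1 hi
  · exact ⟨i, hi, .single h⟩
  · obtain ⟨-, c, hc, hic⟩ := G.mem_foster_iff.1 hi
    exact ⟨c, hc, hic.tail h⟩

theorem disjoint_foster : Disjoint C (G.foster C) :=
  Finset.disjoint_left.2 fun _ hC hF => (G.mem_foster_iff.1 hF).1 hC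

theorem disjoint_q_v : Disjoint (G.q C M) (G.v C M) := Finset.sdiff_disjoint

theorem q_subset_right : G.q C M ⊆ G.right C :=
  (G.q_subset_foster C M).trans (G.foster_subset_right C)

theorem v_subset_right : G.v C M ⊆ G.right C :=
  (G.v_subset_foster C M).trans (G.foster_subset_right C)

theorem notMem_right_of_mem_u (h : i ∈ G.u C M) : i ∉ G.right C :=
  Finset.mem_compl.1 (Finset.mem_sdiff.1 h).1

theorem notMem_right_of_mem_p (h : i ∈ G.p C M) : i ∉ G.right C :=
  Finset.mem_compl.1 (Finset.mem_sdiff.1 h).1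

theorem notMem_p_of_mem_u (h : i ∈ G.u C M) : i ∉ G.p C M := fun hp =>
  (Finset.mem_sdiff.1 hp).2 h

theorem notMem_p_of_mem_right (h : i ∈ G.right C) : i ∉ G.p C M := fun hp =>
  G.notMem_right_of_mem_p hp h

theorem bijective_sumElim_C_foster : Function.Bijective
    (Sum.elim (incl Finset.subset_union_left) (incl (G.foster_subset_right C)) :
      C ⊕ G.foster C → G.right C) :=
  bijective_sumElim_incl _ _ G.disjoint_foster subset_rfl

theorem bijective_sumElim_q_v : Function.Bijective
    (Sum.elim (incl (G.q_subset_foster C M)) (incl (G.v_subset_foster C M))) :=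
  bijective_sumElim_incl _ _ G.disjoint_q_v
    (Finset.sdiff_union_of_subset (G.v_subset_foster C M)).superset

theorem incl_v_notMem_qF (i : G.v C M) : incl (G.v_subset_foster C M) i ∉ G.qF C M := fun h =>
  Finset.disjoint_left.1 G.disjoint_q_v (Finset.mem_subtype.1 h) i.2

variable (C M) in
/-- The identification of `q` with the corresponding subset of the subtype of `F`. -/
def qEquiv : G.q C M ≃ G.qF C M where
  toFun x := ⟨incl (G.q_subset_foster C M) x, Finset.mem_subtype.2 x.2⟩
  invFun x := ⟨x, Finset.mem_subtype.1 x.2⟩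

variable (C M) in
theorem sum_eq_sum_parts (f : Fin d → ℝ) :
    ∑ k, f k = (∑ x : G.u C M, f x) + (∑ x : G.v C M, f x) + (∑ x : G.q C M, f x)
      + (∑ x : G.p C M, f x) + ∑ x : C, f x := by
  simp only [Finset.sum_coe_sort]
  have hV : ∑ k ∈ G.right C, f k + ∑ k ∈ G.outsiders C, f k = ∑ k, f k :=
    Finset.sum_add_sum_compl _ _
  have hR : ∑ k ∈ G.right C, f k = ∑ k ∈ C, f k + ∑ k ∈ G.foster C, f k :=
    Finset.sum_union G.disjoint_foster
  have hF : ∑ k ∈ G.q C M, f k + ∑ k ∈ G.v C M, f k = ∑ k ∈ G.foster C, f k :=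
    Finset.sum_sdiff (G.v_subset_foster C M)
  have hO : ∑ k ∈ G.p C M, f k + ∑ k ∈ G.u C M, f k = ∑ k ∈ G.outsiders C, f k :=
    Finset.sum_sdiff Finset.sdiff_subset
  linarith

/-! ### Parameters and edge matrices in blocks -/

section ParameterBlocks

variable (A : Matrix (Fin d) (Fin d) ℝ) (δ : Fin d → ℝ)

theorem sigmaQQ_eq : G.sigmaQQ C M A δ
    = ((G.conFF C A δ).submatrix (incl (G.q_subset_foster C M))
      (incl (G.q_subset_foster C M)))⁻¹ :=
  partialInv_submatrix₁₁ (G.qEquiv C M) (G.conFF C A δ)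

theorem piQV_eq : G.piQV C M A δ
    = -(((G.conFF C A δ).submatrix (incl (G.q_subset_foster C M))
        (incl (G.q_subset_foster C M)))⁻¹
      * (G.conFF C A δ).submatrix (incl (G.q_subset_foster C M))
        (incl (G.v_subset_foster C M))) :=
  partialInv_submatrix₁₂ (G.qEquiv C M) (G.conFF C A δ) G.incl_v_notMem_qF

theorem sigmaVV_eq : G.sigmaVV C M A δ
    = (G.conFF C A δ).submatrix (incl (G.v_subset_foster C M)) (incl (G.v_subset_foster C M))
      - (G.conFF C A δ).submatrix (incl (G.v_subset_foster C M)) (incl (G.q_subset_foster C M))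
        * ((G.conFF C A δ).submatrix (incl (G.q_subset_foster C M))
          (incl (G.q_subset_foster C M)))⁻¹
        * (G.conFF C A δ).submatrix (incl (G.q_subset_foster C M))
          (incl (G.v_subset_foster C M)) :=
  partialInv_submatrix₂₂ (G.qEquiv C M) (G.conFF C A δ) G.incl_v_notMem_qF G.incl_v_notMem_qF

theorem paramD_submatrix_p {κ : Type*} {f : κ → Fin d} (hf : ∀ k, f k ∉ G.p C M) :
    (G.paramD C M A).submatrix f (fun x : G.p C M => (x : Fin d))
      = A.submatrix f (fun x : G.p C M => (x : Fin d)) * (blk A (G.p C M) (G.p C M))⁻¹ :=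
  partialInv_submatrix₂₁ (Equiv.refl _) A hf

theorem paramD_submatrix {κ l : Type*} {f : κ → Fin d} {g : l → Fin d}
    (hf : ∀ k, f k ∉ G.p C M) (hg : ∀ k, g k ∉ G.p C M) :
    (G.paramD C M A).submatrix f g
      = A.submatrix f g - A.submatrix f (fun x : G.p C M => (x : Fin d))
        * (blk A (G.p C M) (G.p C M))⁻¹ * A.submatrix (fun x : G.p C M => (x : Fin d)) g :=
  partialInv_submatrix₂₂ (Equiv.refl _) A hf hg

end ParameterBlocks

section EdgeBlocks

variable (C M)

theorem edgeSqq_eq : G.edgeSqq C M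
    = In (walkClosure ((G.edgeConFF C).submatrix (incl (G.q_subset_foster C M))
      (incl (G.q_subset_foster C M)))) :=
  partialClosure_submatrix₁₁ (G.qEquiv C M) (G.edgeConFF C)

theorem edgePqv_eq : G.edgePqv C M
    = In (walkClosure ((G.edgeConFF C).submatrix (incl (G.q_subset_foster C M))
        (incl (G.q_subset_foster C M)))
      * (G.edgeConFF C).submatrix (incl (G.q_subset_foster C M))
        (incl (G.v_subset_foster C M))) :=
  partialClosure_submatrix₁₂ (G.qEquiv C M) (G.edgeConFF C) G.incl_v_notMem_qF

theorem edgeSvv_eq : G.edgeSvv C M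
    = In ((G.edgeConFF C).submatrix (incl (G.v_subset_foster C M))
        (incl (G.v_subset_foster C M))
      + (G.edgeConFF C).submatrix (incl (G.v_subset_foster C M)) (incl (G.q_subset_foster C M))
        * walkClosure ((G.edgeConFF C).submatrix (incl (G.q_subset_foster C M))
          (incl (G.q_subset_foster C M)))
        * (G.edgeConFF C).submatrix (incl (G.q_subset_foster C M))
          (incl (G.v_subset_foster C M))) :=
  partialClosure_submatrix₂₂ (G.qEquiv C M) (G.edgeConFF C) G.incl_v_notMem_qF
    G.incl_v_notMem_qF

variable {C M}

theorem edgeD_submatrix_p {κ : Type*} {f : κ → Fin d} (hf : ∀ k, f k ∉ G.p C M) :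
    (G.edgeD C M).submatrix f (fun x : G.p C M => (x : Fin d))
      = In (G.edgeMatrix.submatrix f (fun x : G.p C M => (x : Fin d))
        * walkClosure (blk G.edgeMatrix (G.p C M) (G.p C M))) :=
  partialClosure_submatrix₂₁ (Equiv.refl _) G.edgeMatrix hf

theorem edgeD_submatrix {κ l : Type*} {f : κ → Fin d} {g : l → Fin d}
    (hf : ∀ k, f k ∉ G.p C M) (hg : ∀ k, g k ∉ G.p C M) :
    (G.edgeD C M).submatrix f g
      = In (G.edgeMatrix.submatrix f g
        + G.edgeMatrix.submatrix f (fun x : G.p C M => (x : Fin d))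
          * walkClosure (blk G.edgeMatrix (G.p C M) (G.p C M))
          * G.edgeMatrix.submatrix (fun x : G.p C M => (x : Fin d)) g) :=
  partialClosure_submatrix₂₂ (Equiv.refl _) G.edgeMatrix hf hg

end EdgeBlocks

end ParentGraph

/-! ### Triangular systems -/

theorem inv_eq_transpose_mul_inv_mul {n : Type*} [Fintype n] [DecidableEq n]
    {X S D : Matrix n n ℝ} (hX : IsUnit X.det) (h : X * S * Xᵀ = D) : S⁻¹ = Xᵀ * D⁻¹ * X := by
  rw [← h, Matrix.mul_inv_rev, Matrix.mul_inv_rev,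
    mul_nonsing_inv_cancel_left _ _ (by rwa [det_transpose]), nonsing_inv_mul_cancel_right _ _ hX]

theorem inv_diagonal_eq {n : Type*} [Fintype n] [DecidableEq n] {δ : n → ℝ} (hδ : ∀ i, δ i ≠ 0) :
    (diagonal δ)⁻¹ = diagonal fun i => (δ i)⁻¹ := by
  refine inv_eq_left_inv ?_
  simp only [diagonal_mul_diagonal, inv_mul_cancel₀ (hδ _), diagonal_one]

namespace ParentGraph

variable {d : ℕ} {G : ParentGraph d} {C M : Finset (Fin d)}
  {A : Matrix (Fin d) (Fin d) ℝ} {δ : Fin d → ℝ} {i k : Fin d}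

namespace IsTriangularSystem

variable (hA : G.IsTriangularSystem A δ)

include hA

theorem ne_zero_iff : A i k ≠ 0 ↔ i = k ∨ G.edge i k := by
  rw [← G.edgeMatrix_ne_zero_iff, ← hA.indicator, Ne, Ne, In_eq_zero_iff]

theorem supportedOn : SupportedOn A G.edgeMatrix :=
  ⟨G.edgeMatrix_nonneg, fun i k => by rw [← hA.indicator, In_eq_zero_iff]; exact id⟩

theorem eq_zero_of_lt (h : k < i) : A i k = 0 := by
  by_contra hne
  obtain rfl | he := hA.ne_zero_iff.1 hne
  · exact lt_irrefl _ h
  · exact lt_asymm h (G.lt_of_edge _ _ he)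

theorem mem_right_of_ne_zero (hi : i ∈ G.right C) (h : A i k ≠ 0) : k ∈ G.right C := by
  obtain rfl | he := hA.ne_zero_iff.1 h
  · exact hi
  · exact G.mem_right_of_edge hi he

theorem isUnit_det_blk (a : Finset (Fin d)) : IsUnit (blk A a a).det := by
  have hupper : (blk A a a).IsUpperTriangular := fun i k hki => hA.eq_zero_of_lt hki
  rw [det_of_isUpperTriangular hupper]
  simp [blk, hA.diag]

theorem isUnit_det : IsUnit A.det := by
  have hupper : A.IsUpperTriangular := fun i k hki => hA.eq_zero_of_lt hki
  rw [det_of_isUpperTriangular hupper]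
  simp [hA.diag]

theorem mul_cov_mul_transpose : A * cov A δ * Aᵀ = diagonal δ := by
  rw [cov, transpose_nonsing_inv, Matrix.mul_assoc A⁻¹,
    mul_nonsing_inv_cancel_left _ _ hA.isUnit_det,
    nonsing_inv_mul_cancel_right _ _ (by rw [det_transpose]; exact hA.isUnit_det)]

theorem posDef_cov : (cov A δ).PosDef := by
  have hinv : IsUnit A⁻¹ := (isUnit_iff_isUnit_det _).2 (isUnit_nonsing_inv_det A hA.isUnit_det)
  simpa [cov] using (posDef_diagonal_iff.2 hA.pos).mul_mul_conjTranspose_same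
    (vecMul_injective_of_isUnit hinv)

theorem isSymm_cov : (cov A δ).IsSymm := by
  simpa [IsHermitian, IsSymm] using hA.posDef_cov.isHermitian

theorem posDef_blk_cov (a : Finset (Fin d)) : (blk (cov A δ) a a).PosDef :=
  hA.posDef_cov.submatrix Subtype.val_injective

theorem isUnit_det_blk_cov (a : Finset (Fin d)) : IsUnit (blk (cov A δ) a a).det :=
  (isUnit_iff_isUnit_det _).1 (hA.posDef_blk_cov a).isUnit

theorem blk_right_mul {l m : Type*} (X : Matrix (Fin d) m ℝ) (s : l → m) :
    blk A (G.right C) (G.right C) * X.submatrix (fun i : G.right C => (i : Fin d)) s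
      = (A * X).submatrix (fun i : G.right C => (i : Fin d)) s := by
  rw [← submatrix_mul_add_submatrix_mul (bijective_sumElim_val_compl (G.right C))]
  have hzero : A.submatrix (fun i : G.right C => (i : Fin d))
      (fun k : ((G.right C)ᶜ : Finset (Fin d)) => (k : Fin d)) = 0 := by
    ext i k
    by_contra hne
    exact Finset.mem_compl.1 k.2 (hA.mem_right_of_ne_zero i.2 hne)
  rw [hzero, Matrix.zero_mul, add_zero, blk]

theorem inv_blk_cov_right :
    (blk (cov A δ) (G.right C) (G.right C))⁻¹
      = (blk A (G.right C) (G.right C))ᵀ * diagonal (fun r : G.right C => (δ r)⁻¹)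
        * blk A (G.right C) (G.right C) := by
  have hmul : blk A (G.right C) (G.right C) * blk (cov A δ) (G.right C) (G.right C)
      = blk (A * cov A δ) (G.right C) (G.right C) :=
    hA.blk_right_mul _ _
  have hcov : blk A (G.right C) (G.right C) * blk (cov A δ) (G.right C) (G.right C)
      * (blk A (G.right C) (G.right C))ᵀ = diagonal fun r : G.right C => δ r := by
    calc _ = (blk A (G.right C) (G.right C) * ((A * cov A δ)ᵀ).submatrix
          (fun i : G.right C => (i : Fin d)) (fun i : G.right C => (i : Fin d)))ᵀ := by
          rw [hmul, transpose_mul]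
          rfl
      _ = (A * cov A δ * Aᵀ).submatrix (fun i : G.right C => (i : Fin d))
          (fun i : G.right C => (i : Fin d)) := by
          rw [hA.blk_right_mul, transpose_submatrix, transpose_mul, transpose_transpose]
      _ = _ := by
          rw [hA.mul_cov_mul_transpose, submatrix_diagonal _ _ Subtype.val_injective]
          rfl
  rw [inv_eq_transpose_mul_inv_mul (hA.isUnit_det_blk _) hcov,
    inv_diagonal_eq fun r : G.right C => (hA.pos r).ne']

theorem conFF_eq :
    G.conFF C A δ = (blk A (G.right C) (G.foster C))ᵀ
      * diagonal (fun r : G.right C => (δ r)⁻¹) * blk A (G.right C) (G.foster C) := by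
  rw [conFF, hA.inv_blk_cov_right]
  rfl

theorem posDef_conFF : (G.conFF C A δ).PosDef :=
  (hA.posDef_blk_cov _).inv.submatrix (injective_incl _)

theorem inv_apply_eq_zero_of_mem_right (hi : i ∈ G.right C) (hk : k ∉ G.right C) :
    A⁻¹ i k = 0 := by
  by_contra hne
  have hik := reflTransGen_of_inv_ne_zero hne
  refine hk ?_
  clear hk hne
  induction hik with
  | refl => exact hi
  | tail _ hxy ih => exact hA.mem_right_of_ne_zero ih hxy

theorem mul_cov_apply_eq_zero (hi : i ∉ G.right C) (hk : k ∈ G.right C) :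
    (A * cov A δ) i k = 0 := by
  rw [cov, Matrix.mul_assoc, mul_nonsing_inv_cancel_left _ _ hA.isUnit_det, diagonal_mul,
    transpose_apply, hA.inv_apply_eq_zero_of_mem_right hk hi, mul_zero]

theorem mul_residualCov_apply (hi : i ∉ G.right C) (k : Fin d) :
    (A * residualCov (cov A δ) C) i k = (A * cov A δ) i k := by
  have hC : ∀ c : C, (A * (cov A δ).submatrix id (fun c : C => (c : Fin d))) i c = 0 := fun c =>
    hA.mul_cov_apply_eq_zero hi (Finset.mem_union_left _ c.2)
  rw [residualCov, Matrix.mul_sub, Matrix.sub_apply, ← Matrix.mul_assoc, ← Matrix.mul_assoc,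
    Matrix.mul_assoc (A * _), mul_apply (M := A * (cov A δ).submatrix _ _)]
  simp only [hC, zero_mul, Finset.sum_const_zero, sub_zero]

theorem conFF_mul_residualCov :
    G.conFF C A δ * blk (residualCov (cov A δ) C) (G.foster C) (G.foster C) = 1 :=
  inv_submatrix_mul_schur (e := incl Finset.subset_union_left) G.bijective_sumElim_C_foster
    (hA.isUnit_det_blk_cov (G.right C)) (hA.isUnit_det_blk_cov C)

end IsTriangularSystem

end ParentGraph

/-! ### The summary graph model -/

section OrthogonalResiduals

variable {l m n u v q : Type*} [Fintype n]

theorem fromRows_mul_mul_transpose_fromRows (X : Matrix l n ℝ) (Y : Matrix m n ℝ)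
    (S : Matrix n n ℝ) :
    fromRows X Y * S * (fromRows X Y)ᵀ
      = fromBlocks (X * S * Xᵀ) (X * S * Yᵀ) (Y * S * Xᵀ) (Y * S * Yᵀ) := by
  rw [fromRows_mul, transpose_fromRows, fromRows_mul_fromCols]

theorem sub_mul_mul_mul_transpose_of_orthogonal [Fintype q] {S : Matrix n n ℝ} (hS : S.IsSymm)
    {B : Matrix u n ℝ} {G : Matrix q n ℝ} (hBG : B * S * Gᵀ = 0) (D : Matrix u q ℝ) :
    (B - D * G) * S * (B - D * G)ᵀ = B * S * Bᵀ + D * (G * S * Gᵀ) * Dᵀ := by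
  have hGB : G * S * Bᵀ = 0 := by
    simpa [hS.eq, Matrix.mul_assoc] using congrArg transpose hBG
  have hBD : B * S * (Gᵀ * Dᵀ) = 0 := by rw [← Matrix.mul_assoc, hBG, Matrix.zero_mul]
  have hDB : D * G * S * Bᵀ = 0 := by
    rw [Matrix.mul_assoc D, Matrix.mul_assoc D, hGB, Matrix.mul_zero]
  rw [transpose_sub, transpose_mul, Matrix.sub_mul, Matrix.sub_mul, Matrix.mul_sub, Matrix.mul_sub,
    hBD, hDB]
  simp only [Matrix.mul_assoc, sub_zero, zero_sub, sub_neg_eq_add]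

/-- In terms of a vector `y` with covariance matrix `S`, the equation
`B y = H_uu (U y) + D_uv (V y) + D_uq (Q y)` is turned into one for `U y` and `V y` by splitting
`Q y` into its regression `P (V y)` and a residual, which moves to the left-hand side. -/
theorem fromBlocks_mul_mul_transpose_eq [Fintype u] [Fintype v] [DecidableEq v] [Fintype q]
    {S : Matrix n n ℝ} (hS : S.IsSymm) {U : Matrix u n ℝ} {V : Matrix v n ℝ} {Q : Matrix q n ℝ}
    {B : Matrix u n ℝ} {Huu : Matrix u u ℝ} {Duv : Matrix u v ℝ} {Duq : Matrix u q ℝ}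
    {P : Matrix q v ℝ} {K : Matrix v v ℝ} (hK : K.IsSymm)
    (hB : B * S = (Huu * U + Duv * V + Duq * Q) * S)
    (hBV : B * S * Vᵀ = 0) (hBQ : B * S * Qᵀ = 0)
    (hP : (Q - P * V) * S * Vᵀ = 0) (hKV : K * (V * S * Vᵀ) = 1) :
    fromBlocks Huu (Duv + Duq * P) 0 K * (fromRows U V * S * (fromRows U V)ᵀ)
        * (fromBlocks Huu (Duv + Duq * P) 0 K)ᵀ
      = fromBlocks (B * S * Bᵀ + Duq * ((Q - P * V) * S * Qᵀ) * Duqᵀ) 0 0 K := by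
  set R := Huu * U + (Duv + Duq * P) * V with hR
  have hRS : R * S = (B - Duq * (Q - P * V)) * S := by
    have hsplit : R + Duq * (Q - P * V) = Huu * U + Duv * V + Duq * Q := by
      simp only [hR, Matrix.add_mul, Matrix.mul_sub, Matrix.mul_assoc]
      abel
    rw [Matrix.sub_mul B, hB, ← hsplit, Matrix.add_mul R, add_sub_cancel_right]
  have hRV : R * S * Vᵀ = 0 := by
    rw [hRS, Matrix.sub_mul, Matrix.sub_mul, hBV, Matrix.mul_assoc Duq, Matrix.mul_assoc Duq, hP,
      Matrix.mul_zero, sub_zero]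
  have hVR : V * S * Rᵀ = 0 := by
    simpa [hS.eq, Matrix.mul_assoc] using congrArg transpose hRV
  have hBG : B * S * (Q - P * V)ᵀ = 0 := by
    rw [transpose_sub, transpose_mul, Matrix.mul_sub, hBQ, ← Matrix.mul_assoc, hBV,
      Matrix.zero_mul, sub_zero]
  have hGG : (Q - P * V) * S * (Q - P * V)ᵀ = (Q - P * V) * S * Qᵀ := by
    rw [transpose_sub, transpose_mul, Matrix.mul_sub, ← Matrix.mul_assoc, hP, Matrix.zero_mul,
      sub_zero]
  have hrows : fromBlocks Huu (Duv + Duq * P) 0 K * fromRows U V = fromRows R (K * V) := by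
    rw [fromBlocks_mul_fromRows, Matrix.zero_mul, zero_add]
  calc fromBlocks Huu (Duv + Duq * P) 0 K * (fromRows U V * S * (fromRows U V)ᵀ)
        * (fromBlocks Huu (Duv + Duq * P) 0 K)ᵀ
      = fromRows R (K * V) * S * (fromRows R (K * V))ᵀ := by
        rw [← hrows, transpose_mul]
        simp only [Matrix.mul_assoc]
    _ = fromBlocks (R * S * Rᵀ) (R * S * Vᵀ * Kᵀ) (K * (V * S * Rᵀ)) (K * (V * S * Vᵀ) * Kᵀ) := by
        rw [fromRows_mul_mul_transpose_fromRows]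
        simp only [transpose_mul, Matrix.mul_assoc]
    _ = _ := by
        rw [hRV, hVR, hKV, hK.eq, mul_mul_transpose_eq_of_mul_eq hS hRS,
          sub_mul_mul_mul_transpose_of_orthogonal hS hBG, hGG, Matrix.zero_mul, Matrix.mul_zero,
          Matrix.one_mul]

end OrthogonalResiduals

section Selection

variable {n κ : Type*} [Fintype n] [DecidableEq n]

/-- The matrix of the projection of `ℝⁿ` onto the coordinates in `a`. -/
def proj (a : Finset n) : Matrix a n ℝ := (1 : Matrix n n ℝ).submatrix (fun i => (i : n)) id

theorem proj_mul (a : Finset n) (X : Matrix n κ ℝ) :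
    proj a * X = X.submatrix (fun i : a => (i : n)) id := by
  ext i j
  simp [proj, mul_apply, one_apply]

theorem mul_proj_transpose (X : Matrix κ n ℝ) (a : Finset n) :
    X * (proj a)ᵀ = X.submatrix id (fun i : a => (i : n)) := by
  rw [← transpose_transpose (X * _), transpose_mul, transpose_transpose, proj_mul]
  rfl

theorem proj_mul_mul_proj_transpose (S : Matrix n n ℝ) (a b : Finset n) :
    proj a * S * (proj b)ᵀ = blk S a b := by
  rw [mul_proj_transpose, proj_mul]
  rfl

end Selection

/-- The regression of one block of variables on another, read off the concentration matrix. -/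
theorem submatrix_add_inv_mul_mul {ι κ l n : Type*} [Fintype ι] [DecidableEq ι] [Fintype κ]
    [Fintype n] [DecidableEq n] {K S : Matrix n n ℝ} (hKS : K * S = 1) {e : ι → n} {f : κ → n}
    (h : Function.Bijective (Sum.elim e f)) (hK : IsUnit (K.submatrix e e).det) (g : l → n) :
    S.submatrix e g + (K.submatrix e e)⁻¹ * K.submatrix e f * S.submatrix f g
      = (K.submatrix e e)⁻¹ * (1 : Matrix n n ℝ).submatrix e g := by
  rw [← hKS, ← submatrix_mul_add_submatrix_mul h, Matrix.mul_add,
    nonsing_inv_mul_cancel_left _ _ hK, Matrix.mul_assoc]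

theorem condCov_eq {d : ℕ} (S : Matrix (Fin d) (Fin d) ℝ) (u v C : Finset (Fin d)) :
    condCov S u v C
      = fromRows (proj u) (proj v) * residualCov S C * (fromRows (proj u) (proj v))ᵀ := by
  simp only [fromRows_mul_mul_transpose_fromRows, proj_mul_mul_proj_transpose]
  ext (i | i) (k | k) <;> rfl

namespace ParentGraph

variable {d : ℕ} (G : ParentGraph d) (C M : Finset (Fin d)) {A : Matrix (Fin d) (Fin d) ℝ}
  {δ : Fin d → ℝ}

/-- The coefficient matrix, in all variables, of the equations for `Y_u` that remain after `Y_p`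
has been eliminated from the triangular system `A Y = ε`. -/
def eliminated (A : Matrix (Fin d) (Fin d) ℝ) : Matrix (G.u C M) (Fin d) ℝ :=
  (proj (G.u C M) - blk (G.paramD C M A) (G.u C M) (G.p C M) * proj (G.p C M)) * A

variable {G C M}

theorem eliminated_mul {κ : Type*} (X : Matrix (Fin d) κ ℝ) :
    G.eliminated C M A * X = (A * X).submatrix (fun i : G.u C M => (i : Fin d)) id
      - blk (G.paramD C M A) (G.u C M) (G.p C M)
        * (A * X).submatrix (fun i : G.p C M => (i : Fin d)) id := by
  rw [eliminated, Matrix.mul_assoc, Matrix.sub_mul, Matrix.mul_assoc, proj_mul, proj_mul]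

theorem eliminated_submatrix {κ : Type*} (f : κ → Fin d) :
    (G.eliminated C M A).submatrix id f = A.submatrix (fun i : G.u C M => (i : Fin d)) f
      - blk (G.paramD C M A) (G.u C M) (G.p C M)
        * A.submatrix (fun i : G.p C M => (i : Fin d)) f := by
  rw [← Matrix.mul_one (G.eliminated C M A), eliminated_mul, Matrix.mul_one]
  rfl

theorem eliminated_apply_of_notMem_p (i : G.u C M) {k : Fin d} (hk : k ∉ G.p C M) :
    G.eliminated C M A i k = G.paramD C M A i k := by
  have hu : ∀ i : G.u C M, (i : Fin d) ∉ G.p C M := fun i => G.notMem_p_of_mem_u i.2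
  have hD : (G.eliminated C M A).submatrix id (fun _ : Unit => k)
      = (G.paramD C M A).submatrix (fun i : G.u C M => (i : Fin d)) fun _ : Unit => k := by
    rw [eliminated_submatrix, blk, G.paramD_submatrix_p A hu, G.paramD_submatrix A hu fun _ => hk]
  exact congrFun₂ hD i ()

namespace IsTriangularSystem

variable (hA : G.IsTriangularSystem A δ)

include hA

theorem eliminated_apply_of_mem_p (i : G.u C M) (k : G.p C M) :
    G.eliminated C M A i k = 0 := by
  have hzero : (G.eliminated C M A).submatrix id (fun k : G.p C M => (k : Fin d)) = 0 := by
    rw [eliminated_submatrix, blk,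
      G.paramD_submatrix_p A fun i : G.u C M => G.notMem_p_of_mem_u i.2, sub_eq_zero]
    exact (nonsing_inv_mul_cancel_right _ _ (hA.isUnit_det_blk _)).symm
  exact congrFun₂ hzero i k

theorem eliminated_mul_residualCov_eq_sum :
    G.eliminated C M A * residualCov (cov A δ) C
      = (G.paramHuu C M A * proj (G.u C M)
        + blk (G.paramD C M A) (G.u C M) (G.v C M) * proj (G.v C M)
        + blk (G.paramD C M A) (G.u C M) (G.q C M) * proj (G.q C M))
          * residualCov (cov A δ) C := by
  have hu (x : G.u C M) : (x : Fin d) ∉ G.p C M := G.notMem_p_of_mem_u x.2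
  have hv (x : G.v C M) : (x : Fin d) ∉ G.p C M := G.notMem_p_of_mem_right (G.v_subset_right x.2)
  have hq (x : G.q C M) : (x : Fin d) ∉ G.p C M := G.notMem_p_of_mem_right (G.q_subset_right x.2)
  simp only [Matrix.add_mul, Matrix.mul_assoc, proj_mul]
  ext i k
  simp only [mul_apply, Matrix.add_apply, G.sum_eq_sum_parts C M, hA.eliminated_apply_of_mem_p,
    eliminated_apply_of_notMem_p i (hu _), eliminated_apply_of_notMem_p i (hv _),
    eliminated_apply_of_notMem_p i (hq _),
    residualCov_apply_eq_zero (hA.isUnit_det_blk_cov C) (Subtype.coe_prop _), mul_zero, zero_mul,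
    Finset.sum_const_zero, add_zero]
  rfl

theorem eliminated_mul_residualCov :
    G.eliminated C M A * residualCov (cov A δ) C = G.eliminated C M A * cov A δ := by
  have hrow {a : Finset (Fin d)} (ha : ∀ i ∈ a, i ∉ G.right C) :
      (A * residualCov (cov A δ) C).submatrix (fun i : a => (i : Fin d)) id
        = (A * cov A δ).submatrix (fun i : a => (i : Fin d)) id :=
    Matrix.ext fun i k => hA.mul_residualCov_apply (ha i i.2) k
  rw [eliminated_mul, eliminated_mul, hrow fun _ => G.notMem_right_of_mem_u,
    hrow fun _ => G.notMem_right_of_mem_p]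

theorem eliminated_mul_residualCov_mul_proj {b : Finset (Fin d)} (hb : b ⊆ G.right C) :
    G.eliminated C M A * residualCov (cov A δ) C * (proj b)ᵀ = 0 := by
  have hzero {a : Finset (Fin d)} (ha : ∀ i ∈ a, i ∉ G.right C) :
      (A * (cov A δ * (proj b)ᵀ)).submatrix (fun i : a => (i : Fin d)) id = 0 := by
    rw [← Matrix.mul_assoc, mul_proj_transpose]
    exact Matrix.ext fun i k => hA.mul_cov_apply_eq_zero (ha i i.2) (hb k.2)
  rw [hA.eliminated_mul_residualCov, Matrix.mul_assoc, eliminated_mul,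
    hzero fun _ => G.notMem_right_of_mem_u, hzero fun _ => G.notMem_right_of_mem_p,
    Matrix.mul_zero, sub_zero]

theorem eliminated_mul_residualCov_mul_transpose :
    G.eliminated C M A * residualCov (cov A δ) C * (G.eliminated C M A)ᵀ
      = blk (diagonal δ) (G.u C M) (G.u C M)
        + blk (G.paramD C M A) (G.u C M) (G.p C M) * blk (diagonal δ) (G.p C M) (G.p C M)
          * (blk (G.paramD C M A) (G.u C M) (G.p C M))ᵀ := by
  set L := proj (G.u C M) - blk (G.paramD C M A) (G.u C M) (G.p C M) * proj (G.p C M)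
  have horth : proj (G.u C M) * diagonal δ * (proj (G.p C M))ᵀ = 0 := by
    rw [proj_mul_mul_proj_transpose]
    exact Matrix.ext fun i k => diagonal_apply_ne _ fun h =>
      G.notMem_p_of_mem_u i.2 ((show (i : Fin d) = k from h) ▸ k.2)
  calc G.eliminated C M A * residualCov (cov A δ) C * (G.eliminated C M A)ᵀ
      = L * (A * cov A δ * Aᵀ) * Lᵀ := by
        rw [hA.eliminated_mul_residualCov, eliminated, transpose_mul]
        simp only [Matrix.mul_assoc, L]
    _ = _ := by
        rw [hA.mul_cov_mul_transpose, sub_mul_mul_mul_transpose_of_orthogonal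
          (isSymm_diagonal δ) horth, proj_mul_mul_proj_transpose, proj_mul_mul_proj_transpose]

theorem isUnit_det_conFF_q : IsUnit ((G.conFF C A δ).submatrix (incl (G.q_subset_foster C M))
    (incl (G.q_subset_foster C M))).det :=
  (isUnit_iff_isUnit_det _).1 (hA.posDef_conFF.submatrix (injective_incl _)).isUnit

theorem blk_residualCov_sub_piQV_mul {b : Finset (Fin d)} (hb : b ⊆ G.foster C) :
    blk (residualCov (cov A δ) C) (G.q C M) b
        - G.piQV C M A δ * blk (residualCov (cov A δ) C) (G.v C M) b
      = G.sigmaQQ C M A δ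
        * (1 : Matrix (G.foster C) (G.foster C) ℝ).submatrix (incl (G.q_subset_foster C M))
          (incl hb) := by
  rw [G.piQV_eq, G.sigmaQQ_eq, Matrix.neg_mul, sub_neg_eq_add]
  exact submatrix_add_inv_mul_mul hA.conFF_mul_residualCov G.bijective_sumElim_q_v
    hA.isUnit_det_conFF_q (incl hb)

theorem proj_q_sub_mul_residualCov_mul {b : Finset (Fin d)} (hb : b ⊆ G.foster C) :
    (proj (G.q C M) - G.piQV C M A δ * proj (G.v C M)) * residualCov (cov A δ) C * (proj b)ᵀ
      = G.sigmaQQ C M A δ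
        * (1 : Matrix (G.foster C) (G.foster C) ℝ).submatrix (incl (G.q_subset_foster C M))
          (incl hb) := by
  rw [← hA.blk_residualCov_sub_piQV_mul hb, ← proj_mul_mul_proj_transpose,
    ← proj_mul_mul_proj_transpose]
  simp only [Matrix.sub_mul, Matrix.mul_assoc]

theorem sigmaVV_mul_blk_residualCov :
    G.sigmaVV C M A δ * blk (residualCov (cov A δ) C) (G.v C M) (G.v C M) = 1 := by
  have hinv : (G.conFF C A δ)⁻¹ = blk (residualCov (cov A δ) C) (G.foster C) (G.foster C) :=
    inv_eq_right_inv hA.conFF_mul_residualCov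
  have hschur := inv_submatrix_mul_schur (G.bijective_sumElim_q_v (C := C) (M := M))
    ((isUnit_iff_isUnit_det _).1 hA.posDef_conFF.isUnit) hA.isUnit_det_conFF_q
  rw [← G.sigmaVV_eq, hinv] at hschur
  exact mul_eq_one_comm.1 hschur

theorem posDef_sigmaQQ : (G.sigmaQQ C M A δ).PosDef := by
  rw [G.sigmaQQ_eq]
  exact (hA.posDef_conFF.submatrix (injective_incl _)).inv

theorem posDef_sigmaVV : (G.sigmaVV C M A δ).PosDef := by
  rw [← inv_eq_left_inv hA.sigmaVV_mul_blk_residualCov]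
  have hF : (blk (residualCov (cov A δ) C) (G.foster C) (G.foster C)).PosDef := by
    rw [← inv_eq_right_inv hA.conFF_mul_residualCov]
    exact hA.posDef_conFF.inv
  exact (hF.submatrix (injective_incl (G.v_subset_foster C M))).inv

theorem posDef_paramWuu : (G.paramWuu C M A δ).PosDef := by
  have hδ : (diagonal δ).PosDef := posDef_diagonal_iff.2 hA.pos
  have hp : (blk (G.paramD C M A) (G.u C M) (G.p C M) * blk (diagonal δ) (G.p C M) (G.p C M)
      * (blk (G.paramD C M A) (G.u C M) (G.p C M))ᵀ).PosSemidef := by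
    have hδp : (blk (diagonal δ) (G.p C M) (G.p C M)).PosSemidef := hδ.posSemidef.submatrix _
    simpa using hδp.mul_mul_conjTranspose_same
      (blk (G.paramD C M A) (G.u C M) (G.p C M))
  have hq : (blk (G.paramD C M A) (G.u C M) (G.q C M) * G.sigmaQQ C M A δ
      * (blk (G.paramD C M A) (G.u C M) (G.q C M))ᵀ).PosSemidef := by
    simpa using (hA.posDef_sigmaQQ (C := C) (M := M)).posSemidef.mul_mul_conjTranspose_same
      (blk (G.paramD C M A) (G.u C M) (G.q C M))
  exact ((hδ.submatrix Subtype.val_injective).add_posSemidef hp).add_posSemidef hq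

theorem paramD_apply_of_le {i k : Fin d} (hi : i ∉ G.p C M) (hk : k ∉ G.p C M) (hki : k ≤ i) :
    G.paramD C M A i k = A i k := by
  have hle {a b : Fin d} (h : A a b ≠ 0) : a ≤ b := not_lt.1 fun hlt => h (hA.eq_zero_of_lt hlt)
  have hD := congrFun₂ (G.paramD_submatrix A (f := fun _ : Unit => i) (g := fun _ : Unit => k)
    (fun _ => hi) fun _ => hk) () ()
  refine hD.trans (sub_eq_self.2 ?_)
  by_contra hne
  obtain ⟨y, -, hy⟩ := Finset.exists_ne_zero_of_sum_ne_zero hne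
  obtain ⟨x, -, hx⟩ := Finset.exists_ne_zero_of_sum_ne_zero (left_ne_zero_of_mul hy)
  have hxy : (x : Fin d) ≤ y := by
    have hwalk := reflTransGen_of_inv_ne_zero (right_ne_zero_of_mul hx)
    clear hx hy
    induction hwalk with
    | refl => exact le_rfl
    | tail _ hbc ih => exact ih.trans (hle hbc)
  have hxi : (x : Fin d) = i :=
    le_antisymm (hxy.trans ((hle (right_ne_zero_of_mul hy)).trans hki))
      (hle (left_ne_zero_of_mul hx))
  exact hi (hxi ▸ x.2)

theorem residual_summary :
    fromBlocks (G.paramHuu C M A) (G.paramHuv C M A δ) 0 (G.sigmaVV C M A δ)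
        * condCov (cov A δ) (G.u C M) (G.v C M) C
        * (fromBlocks (G.paramHuu C M A) (G.paramHuv C M A δ) 0 (G.sigmaVV C M A δ))ᵀ
      = fromBlocks (G.paramWuu C M A δ) 0 0 (G.sigmaVV C M A δ) := by
  have hsymm : (G.sigmaVV C M A δ).IsSymm := by
    simpa [IsHermitian, IsSymm] using (hA.posDef_sigmaVV (C := C) (M := M)).isHermitian
  have hqv : (proj (G.q C M) - G.piQV C M A δ * proj (G.v C M)) * residualCov (cov A δ) C
      * (proj (G.v C M))ᵀ = 0 := by
    rw [hA.proj_q_sub_mul_residualCov_mul (G.v_subset_foster C M)]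
    convert Matrix.mul_zero (G.sigmaQQ C M A δ)
    exact Matrix.ext fun i k => one_apply_ne fun h => Finset.disjoint_left.1 G.disjoint_q_v i.2
      ((congrArg Subtype.val h : i.1 = k.1) ▸ k.2)
  have hqq : (proj (G.q C M) - G.piQV C M A δ * proj (G.v C M)) * residualCov (cov A δ) C
      * (proj (G.q C M))ᵀ = G.sigmaQQ C M A δ := by
    rw [hA.proj_q_sub_mul_residualCov_mul (G.q_subset_foster C M),
      submatrix_one _ (injective_incl _), Matrix.mul_one]
  rw [condCov_eq, paramHuv, fromBlocks_mul_mul_transpose_eq (isSymm_residualCov hA.isSymm_cov) hsymm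
    hA.eliminated_mul_residualCov_eq_sum
    (hA.eliminated_mul_residualCov_mul_proj G.v_subset_right)
    (hA.eliminated_mul_residualCov_mul_proj G.q_subset_right) hqv
    (by rw [proj_mul_mul_proj_transpose, hA.sigmaVV_mul_blk_residualCov]),
    hA.eliminated_mul_residualCov_mul_transpose, hqq]
  rfl

theorem isGaussianSummaryModel :
    IsGaussianSummaryModel (condCov (cov A δ) (G.u C M) (G.v C M) C)
      (G.paramHuu C M A) (G.paramHuv C M A δ) (G.sigmaVV C M A δ) (G.paramWuu C M A δ) where
  diag i := (hA.paramD_apply_of_le (G.notMem_p_of_mem_u i.2) (G.notMem_p_of_mem_u i.2)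
    le_rfl).trans (hA.diag i)
  upper i k hik := (hA.paramD_apply_of_le (G.notMem_p_of_mem_u i.2) (G.notMem_p_of_mem_u k.2)
    hik.le).trans (hA.eq_zero_of_lt hik)
  posDef_W := hA.posDef_paramWuu
  posDef_K := hA.posDef_sigmaVV
  concentration := (inv_eq_left_inv hA.sigmaVV_mul_blk_residualCov).symm
  residual := hA.residual_summary

end IsTriangularSystem

end ParentGraph

/-! ### Gram matrices and their resolvents -/

theorem analyticAt_det {n : Type*} [Fintype n] [DecidableEq n] {X : ℝ → Matrix n n ℝ} {a : ℝ}
    (hX : ∀ i j, AnalyticAt ℝ (fun s => X s i j) a) : AnalyticAt ℝ (fun s => (X s).det) a := by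
  simp only [det_apply']
  fun_prop

theorem analyticAt_inv_apply {n : Type*} [Fintype n] [DecidableEq n] {X : ℝ → Matrix n n ℝ}
    {a : ℝ} (hX : ∀ i j, AnalyticAt ℝ (fun s => X s i j) a) (ha : IsUnit (X a).det) (i j : n) :
    AnalyticAt ℝ (fun s => (X s)⁻¹ i j) a := by
  simp only [inv_def, Matrix.smul_apply, smul_eq_mul, Ring.inverse_eq_inv', adjugate_apply]
  refine ((analyticAt_det hX).inv ha.ne_zero).mul (analyticAt_det fun k l => ?_)
  by_cases hk : k = j
  · simp only [hk, updateRow_self]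
    exact analyticAt_const
  · simpa only [updateRow_ne hk] using hX k l

section Resolvent

variable {z q v : Type*} [Fintype z] [Fintype q] [DecidableEq q] {s : ℝ}

/-- The resolvent `(1 + s EᵀE)⁻¹` of the Gram matrix of `E`. -/
def gramResolvent (E : Matrix z q ℝ) (s : ℝ) : Matrix q q ℝ := (1 + s • (Eᵀ * E))⁻¹

theorem isUnit_det_one_add_smul_gram (E : Matrix z q ℝ) (hs : 0 ≤ s) :
    IsUnit (1 + s • (Eᵀ * E)).det := by
  have hE : (Eᵀ * E).PosSemidef := by simpa using posSemidef_conjTranspose_mul_self E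
  exact (isUnit_iff_isUnit_det _).1 (PosDef.one.add_posSemidef (hE.smul hs)).isUnit

theorem inv_gram_add_smul_gram (E : Matrix z q ℝ) (Q : Matrix q q ℝ) (s : ℝ) :
    (Qᵀ * Q + s • ((E * Q)ᵀ * (E * Q)))⁻¹ = Q⁻¹ * gramResolvent E s * (Q⁻¹)ᵀ := by
  have hfactor : Qᵀ * Q + s • ((E * Q)ᵀ * (E * Q)) = Qᵀ * (1 + s • (Eᵀ * E)) * Q := by
    simp only [transpose_mul, Matrix.mul_add, Matrix.add_mul, Matrix.mul_smul, Matrix.smul_mul,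
      Matrix.mul_one, Matrix.mul_assoc]
  rw [hfactor, Matrix.mul_inv_rev, Matrix.mul_inv_rev, transpose_nonsing_inv, gramResolvent,
    Matrix.mul_assoc]

variable {E : Matrix z q ℝ} {Q : Matrix q q ℝ} {X : Matrix q v ℝ} {N : Matrix z v ℝ}

theorem inv_gram_add_smul_gram_mul (hQ : IsUnit Q.det) (hs : 0 ≤ s) :
    (Qᵀ * Q + s • ((E * Q)ᵀ * (E * Q)))⁻¹ * (Qᵀ * X + s • ((E * Q)ᵀ * (N + E * X)))
      = Q⁻¹ * (X + s • (gramResolvent E s * (Eᵀ * N))) := by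
  have hfactor : Qᵀ * X + s • ((E * Q)ᵀ * (N + E * X))
      = Qᵀ * ((1 + s • (Eᵀ * E)) * X + s • (Eᵀ * N)) := by
    simp only [transpose_mul, Matrix.mul_add, Matrix.add_mul, Matrix.mul_smul, Matrix.smul_mul,
      Matrix.one_mul, Matrix.mul_assoc, smul_add]
    abel
  rw [inv_gram_add_smul_gram, hfactor, transpose_nonsing_inv, Matrix.mul_assoc,
    nonsing_inv_mul_cancel_left _ _ (by rwa [det_transpose]), Matrix.mul_assoc, Matrix.mul_add,
    gramResolvent, nonsing_inv_mul_cancel_left _ _ (isUnit_det_one_add_smul_gram E hs),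
    Matrix.mul_smul]

theorem gram_add_smul_gram_schur (hQ : IsUnit Q.det) (hs : 0 ≤ s) :
    Xᵀ * X + s • ((N + E * X)ᵀ * (N + E * X))
        - (Xᵀ * Q + s • ((N + E * X)ᵀ * (E * Q)))
          * (Qᵀ * Q + s • ((E * Q)ᵀ * (E * Q)))⁻¹
          * (Qᵀ * X + s • ((E * Q)ᵀ * (N + E * X)))
      = s • (Nᵀ * N + (-s) • (Nᵀ * E * gramResolvent E s * (Eᵀ * N))) := by
  set V := gramResolvent E s * (Eᵀ * N) with hV
  have hKV : V + s • (Eᵀ * (E * V)) = Eᵀ * N := by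
    rw [← Matrix.mul_assoc, ← Matrix.smul_mul, ← Matrix.one_mul V, ← Matrix.mul_assoc _ 1,
      Matrix.mul_one, ← Matrix.add_mul, hV, gramResolvent,
      mul_nonsing_inv_cancel_left _ _ (isUnit_det_one_add_smul_gram E hs)]
  have hfactor : Xᵀ * Q + s • ((N + E * X)ᵀ * (E * Q))
      = (Xᵀ + s • ((N + E * X)ᵀ * E)) * Q := by
    simp only [Matrix.add_mul, Matrix.smul_mul, Matrix.mul_assoc]
  have hXV : Xᵀ * (Eᵀ * N) = Xᵀ * V + s • (Xᵀ * (Eᵀ * (E * V))) := by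
    rw [← hKV, Matrix.mul_add, Matrix.mul_smul]
  rw [Matrix.mul_assoc, inv_gram_add_smul_gram_mul hQ hs, hfactor, Matrix.mul_assoc _ Q,
    mul_nonsing_inv_cancel_left _ _ hQ, Matrix.mul_assoc _ (gramResolvent E s), ← hV]
  simp only [transpose_add, transpose_mul, Matrix.add_mul, Matrix.mul_add, Matrix.smul_mul,
    Matrix.mul_smul, Matrix.mul_assoc, hXV, smul_add]
  module

theorem eventually_posOn_gramResolvent {F : Matrix q q ℝ} (h0 : ∀ i j, 0 ≤ F i j)
    (h1 : ∀ i j, F i j ≤ 1) (hE : PosOn F (Eᵀ * E)) :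
    ∀ᶠ s in 𝓝[<] (0 : ℝ), PosOn (walkClosure F) (gramResolvent E s) := by
  have hrow : ∀ᶠ s in 𝓝[<] (0 : ℝ), ∀ i, 0 < ∑ j, (1 + s • (Eᵀ * E) : Matrix q q ℝ) i j := by
    refine nhdsWithin_le_nhds (Filter.eventually_all.2 fun i => ?_)
    have hcont : Continuous fun s : ℝ => ∑ j, (1 + s • (Eᵀ * E) : Matrix q q ℝ) i j := by
      simp only [Matrix.add_apply, Matrix.smul_apply, smul_eq_mul]
      fun_prop
    exact hcont.continuousAt.eventually_const_lt (by simp [one_apply])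
  filter_upwards [hrow, self_mem_nhdsWithin] with s hrow hs
  have hoff {i j : q} (hij : i ≠ j) : (1 + s • (Eᵀ * E) : Matrix q q ℝ) i j = s * (Eᵀ * E) i j := by
    simp [one_apply_ne hij]
  refine (IsMMatrix.of_sum_row_pos (fun i j hij => ?_) hrow).posOn_inv h0 h1 fun i j hij hF => ?_
  · exact (hoff hij).trans_le (mul_nonpos_of_nonpos_of_nonneg (le_of_lt hs) (hE.nonneg i j))
  · exact (hoff hij).trans_ne (mul_ne_zero (ne_of_lt hs) (hE.pos i j hF).ne')

theorem analyticAt_gramResolvent_apply (E : Matrix z q ℝ) (i j : q) :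
    AnalyticAt ℝ (fun s => gramResolvent E s i j) 0 := by
  refine analyticAt_inv_apply (fun a b => ?_) (isUnit_det_one_add_smul_gram E le_rfl) i j
  simp only [Matrix.add_apply, Matrix.smul_apply, smul_eq_mul]
  fun_prop

end Resolvent

theorem exists_pos_apply_ne_zero {m n : Type*} {Y : ℝ → Matrix m n ℝ} {F : Matrix m n ℝ}
    {i : m} {j : n} (hY : AnalyticAt ℝ (fun s => Y s i j) 0)
    (hpos : ∀ᶠ s in 𝓝[<] (0 : ℝ), PosOn F (Y s)) (h : F i j ≠ 0) : ∃ s > 0, Y s i j ≠ 0 := by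
  have hne : ∃ᶠ s in 𝓝 (0 : ℝ), Y s i j ≠ 0 :=
    ((hpos.mono fun s hs => (hs.pos i j h).ne').frequently).filter_mono nhdsWithin_le_nhds
  have hev := hY.eventually_eq_zero_or_eventually_ne_zero.resolve_left fun h0 =>
    hne (h0.mono fun s hs => not_not.2 hs)
  have hright : ∀ᶠ s in 𝓝[>] (0 : ℝ), Y s i j ≠ 0 :=
    hev.filter_mono (nhdsWithin_mono 0 fun s (hs : 0 < s) => hs.ne')
  obtain ⟨s, hs, hs0⟩ := (hright.and self_mem_nhdsWithin).exists
  exact ⟨s, hs0, hs⟩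

/-! ### Triangular systems without cancellation -/

namespace ParentGraph

variable {d : ℕ} (G : ParentGraph d) (C M : Finset (Fin d))

/-- The nodes of `R = C ∪ F` over which one does not marginalise. -/
def observed : Finset (Fin d) := G.right C \ G.q C M

open Classical in
/-- The coefficient matrix of a triangular system in which effects do not cancel: rows in
`observed` have non-negative entries, and all other rows form an M-matrix. -/
def testMatrix : Matrix (Fin d) (Fin d) ℝ :=
  Matrix.of fun i k => if i ∈ G.observed C M then G.edgeMatrix i k
    else (1 + ((d : ℝ) + 1)⁻¹) * (1 : Matrix (Fin d) (Fin d) ℝ) i k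
      - ((d : ℝ) + 1)⁻¹ * G.edgeMatrix i k

/-- Residual variances that are `s⁻¹` on `observed` and one elsewhere. -/
def testVar (s : ℝ) : Fin d → ℝ := fun i => if i ∈ G.observed C M then s⁻¹ else 1

variable {C M} {i k : Fin d} {κ l : Type*} {f : κ → Fin d} {g : l → Fin d}

theorem notMem_observed_of_mem_q (hi : i ∈ G.q C M) : i ∉ G.observed C M := fun h =>
  (Finset.mem_sdiff.1 h).2 hi

theorem notMem_observed_of_notMem_right (hi : i ∉ G.right C) : i ∉ G.observed C M := fun h =>
  hi (Finset.mem_sdiff.1 h).1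

theorem testMatrix_apply_of_mem (hi : i ∈ G.observed C M) :
    G.testMatrix C M i k = G.edgeMatrix i k := by
  simp [testMatrix, hi]

theorem testMatrix_apply_of_notMem (hi : i ∉ G.observed C M) :
    G.testMatrix C M i k = (1 + ((d : ℝ) + 1)⁻¹) * (1 : Matrix (Fin d) (Fin d) ℝ) i k
      - ((d : ℝ) + 1)⁻¹ * G.edgeMatrix i k := by
  simp [testMatrix, hi]

theorem testMatrix_apply_of_ne (hi : i ∉ G.observed C M) (hik : i ≠ k) :
    -G.testMatrix C M i k = ((d : ℝ) + 1)⁻¹ * G.edgeMatrix i k := by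
  rw [G.testMatrix_apply_of_notMem hi, one_apply_ne hik, mul_zero, zero_sub, neg_neg]

theorem testMatrix_apply_self (i : Fin d) : G.testMatrix C M i i = 1 := by
  have hedge : G.edgeMatrix i i = 1 := by simp [edgeMatrix]
  by_cases hi : i ∈ G.observed C M
  · rw [G.testMatrix_apply_of_mem hi, hedge]
  · rw [G.testMatrix_apply_of_notMem hi, hedge, one_apply_eq, mul_one, mul_one,
      add_sub_cancel_right]

theorem testMatrix_eq_zero_iff : G.testMatrix C M i k = 0 ↔ G.edgeMatrix i k = 0 := by
  obtain rfl | hik := eq_or_ne i k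
  · simp [G.testMatrix_apply_self, edgeMatrix]
  by_cases hi : i ∈ G.observed C M
  · rw [G.testMatrix_apply_of_mem hi]
  · rw [← neg_eq_zero, G.testMatrix_apply_of_ne hi hik, mul_eq_zero_iff_left (by positivity)]

theorem isTriangularSystem_test {s : ℝ} (hs : 0 < s) :
    G.IsTriangularSystem (G.testMatrix C M) (G.testVar C M s) where
  diag := G.testMatrix_apply_self
  indicator := by
    ext i k
    by_cases hik : i = k ∨ G.edge i k <;>
      simp [In, G.testMatrix_eq_zero_iff, edgeMatrix, hik]
  pos i := by
    simp only [testVar]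
    split_ifs
    · exact inv_pos.2 hs
    · exact one_pos

theorem posOn_testMatrix (hf : ∀ i, f i ∈ G.observed C M) :
    PosOn (G.edgeMatrix.submatrix f g) ((G.testMatrix C M).submatrix f g) where
  nonneg i _ := (G.edgeMatrix_nonneg _ _).trans_eq (G.testMatrix_apply_of_mem (hf i)).symm
  pos i _ hik := ((G.edgeMatrix_nonneg _ _).lt_of_ne' hik).trans_eq
    (G.testMatrix_apply_of_mem (hf i)).symm

theorem posOn_neg_testMatrix (hf : ∀ i, f i ∉ G.observed C M) (hfg : ∀ i k, f i ≠ g k) :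
    PosOn (G.edgeMatrix.submatrix f g) (-(G.testMatrix C M).submatrix f g) where
  nonneg i k := (mul_nonneg (by positivity) (G.edgeMatrix_nonneg _ _)).trans_eq
    (G.testMatrix_apply_of_ne (hf i) (hfg i k)).symm
  pos i k hik := (mul_pos (by positivity) ((G.edgeMatrix_nonneg _ _).lt_of_ne' hik)).trans_eq
    (G.testMatrix_apply_of_ne (hf i) (hfg i k)).symm

variable {a : Finset (Fin d)}

theorem isMMatrix_blk_test (ha : ∀ i ∈ a, i ∉ G.observed C M) :
    IsMMatrix (blk (G.testMatrix C M) a a) := by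
  have hblk : blk (G.testMatrix C M) a a = (1 + ((d : ℝ) + 1)⁻¹) • (1 : Matrix a a ℝ)
      - ((d : ℝ) + 1)⁻¹ • blk G.edgeMatrix a a := by
    ext i k
    simp [blk, G.testMatrix_apply_of_notMem (ha i i.2), one_apply]
  rw [hblk]
  refine isMMatrix_smul_one_sub (fun i k => mul_nonneg (by positivity) (G.edgeMatrix_nonneg _ _))
    fun i => ?_
  have hcard : ∑ k, blk G.edgeMatrix a a i k ≤ d :=
    (sum_row_le_card (fun i k : a => G.edgeMatrix_le_one i k) i).trans
      (Nat.cast_le.2 (by simpa using Finset.card_le_univ a))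
  calc ∑ k, (((d : ℝ) + 1)⁻¹ • blk G.edgeMatrix a a) i k
      = ((d : ℝ) + 1)⁻¹ * ∑ k, blk G.edgeMatrix a a i k := (Finset.mul_sum ..).symm
    _ ≤ ((d : ℝ) + 1)⁻¹ * (d + 1) := by gcongr; linarith
    _ = 1 := inv_mul_cancel₀ (by positivity)
    _ < 1 + ((d : ℝ) + 1)⁻¹ := lt_add_of_pos_right _ (by positivity)

theorem posOn_inv_blk_test (ha : ∀ i ∈ a, i ∉ G.observed C M) :
    PosOn (walkClosure (blk G.edgeMatrix a a)) (blk (G.testMatrix C M) a a)⁻¹ :=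
  (G.isMMatrix_blk_test ha).posOn_inv (fun _ _ => G.edgeMatrix_nonneg _ _)
    (fun _ _ => G.edgeMatrix_le_one _ _) fun _ _ _ hik => mt G.testMatrix_eq_zero_iff.1 hik

theorem posOn_neg_paramD_test_p (hf : ∀ i, f i ∈ G.u C M) :
    PosOn ((G.edgeD C M).submatrix f fun x : G.p C M => (x : Fin d))
      (-(G.paramD C M (G.testMatrix C M)).submatrix f fun x : G.p C M => (x : Fin d)) := by
  have hp {i : κ} : f i ∉ G.p C M := G.notMem_p_of_mem_u (hf i)
  rw [G.edgeD_submatrix_p fun _ => hp, G.paramD_submatrix_p _ fun _ => hp, ← Matrix.neg_mul]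
  refine ((G.posOn_neg_testMatrix (fun i => ?_) fun i x h => hp (h ▸ x.2)).mul
    (G.posOn_inv_blk_test fun x hx => ?_)).In
  · exact G.notMem_observed_of_notMem_right (G.notMem_right_of_mem_u (hf i))
  · exact G.notMem_observed_of_notMem_right (G.notMem_right_of_mem_p hx)

theorem posOn_neg_paramD_test (hf : ∀ i, f i ∈ G.u C M) (hg : ∀ k, g k ∉ G.p C M)
    (hfg : ∀ i k, f i ≠ g k) :
    PosOn ((G.edgeD C M).submatrix f g)
      (-(G.paramD C M (G.testMatrix C M)).submatrix f g) := by
  have hp {i : κ} : f i ∉ G.p C M := G.notMem_p_of_mem_u (hf i)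
  have hu (i : κ) : f i ∉ G.observed C M :=
    G.notMem_observed_of_notMem_right (G.notMem_right_of_mem_u (hf i))
  have hpo {x : Fin d} (hx : x ∈ G.p C M) : x ∉ G.observed C M :=
    G.notMem_observed_of_notMem_right (G.notMem_right_of_mem_p hx)
  have hneg : -(G.paramD C M (G.testMatrix C M)).submatrix f g
      = -(G.testMatrix C M).submatrix f g
        + -(G.testMatrix C M).submatrix f (fun x : G.p C M => (x : Fin d))
          * (blk (G.testMatrix C M) (G.p C M) (G.p C M))⁻¹
          * -(G.testMatrix C M).submatrix (fun x : G.p C M => (x : Fin d)) g := by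
    rw [G.paramD_submatrix _ (fun _ => hp) hg, neg_sub', sub_neg_eq_add, Matrix.neg_mul,
      Matrix.neg_mul, Matrix.mul_neg, neg_neg]
  rw [G.edgeD_submatrix (fun _ => hp) hg, hneg]
  exact ((G.posOn_neg_testMatrix hu hfg).add
    (((G.posOn_neg_testMatrix hu fun i x h => hp (h ▸ x.2)).mul
      (G.posOn_inv_blk_test fun _ => hpo)).mul
      (G.posOn_neg_testMatrix (fun x => hpo x.2) fun x k h => hg k (by rw [← h]; exact x.2)))).In

end ParentGraph

/-! ### Concentration matrices without cancellation -/

namespace ParentGraph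

variable {d : ℕ} (G : ParentGraph d) (C M : Finset (Fin d))

/-- The effects of the residuals of `q` (columns in `q`) and of the other variables (columns
outside `q`) in the equations of the observed nodes, after `Y_q` has been eliminated. -/
def testEffect : Matrix (G.observed C M) (Fin d) ℝ :=
  (G.testMatrix C M).submatrix (fun z : G.observed C M => (z : Fin d)) id
    + blk (G.testMatrix C M) (G.observed C M) (G.q C M)
      * (blk (G.testMatrix C M) (G.q C M) (G.q C M))⁻¹
      * (1 - G.testMatrix C M).submatrix (fun x : G.q C M => (x : Fin d)) id

/-- The columns of `testEffect` in `q`. -/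
def testEffectQ : Matrix (G.observed C M) (G.q C M) ℝ :=
  (G.testEffect C M).submatrix id fun x : G.q C M => (x : Fin d)

/-- The columns of `testEffect` in `v`. -/
def testEffectV : Matrix (G.observed C M) (G.v C M) ℝ :=
  (G.testEffect C M).submatrix id fun x : G.v C M => (x : Fin d)

variable {C M} {i k r : Fin d} {κ l : Type*}

theorem isMMatrix_blk_test_q : IsMMatrix (blk (G.testMatrix C M) (G.q C M) (G.q C M)) :=
  G.isMMatrix_blk_test fun _ => G.notMem_observed_of_mem_q

theorem testEffectQ_eq : G.testEffectQ C M
    = blk (G.testMatrix C M) (G.observed C M) (G.q C M)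
      * (blk (G.testMatrix C M) (G.q C M) (G.q C M))⁻¹ := by
  set T := blk (G.testMatrix C M) (G.q C M) (G.q C M)
  have hone : (1 - G.testMatrix C M).submatrix (fun x : G.q C M => (x : Fin d))
      (fun x : G.q C M => (x : Fin d)) = 1 - T :=
    congrArg (· - T) (submatrix_one _ Subtype.val_injective)
  calc G.testEffectQ C M
      = blk (G.testMatrix C M) (G.observed C M) (G.q C M)
        + blk (G.testMatrix C M) (G.observed C M) (G.q C M) * T⁻¹ * (1 - T) := by
        rw [← hone]
        rfl
    _ = blk (G.testMatrix C M) (G.observed C M) (G.q C M) * T⁻¹ := by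
        rw [Matrix.mul_sub, Matrix.mul_one,
          nonsing_inv_mul_cancel_right _ _ G.isMMatrix_blk_test_q.isUnit_det,
          add_sub_cancel]

theorem testEffectQ_mul : G.testEffectQ C M * blk (G.testMatrix C M) (G.q C M) (G.q C M)
    = blk (G.testMatrix C M) (G.observed C M) (G.q C M) := by
  rw [G.testEffectQ_eq, nonsing_inv_mul_cancel_right _ _ G.isMMatrix_blk_test_q.isUnit_det]

theorem testEffect_eq : G.testEffect C M
    = (G.testMatrix C M).submatrix (fun z : G.observed C M => (z : Fin d)) id
      + G.testEffectQ C M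
        * (1 - G.testMatrix C M).submatrix (fun x : G.q C M => (x : Fin d)) id := by
  rw [G.testEffectQ_eq, testEffect]

theorem testEffectV_add : G.testEffectV C M
    + G.testEffectQ C M * blk (G.testMatrix C M) (G.q C M) (G.v C M)
      = blk (G.testMatrix C M) (G.observed C M) (G.v C M) := by
  have hzero : (1 - G.testMatrix C M).submatrix (fun x : G.q C M => (x : Fin d))
      (fun x : G.v C M => (x : Fin d)) = -blk (G.testMatrix C M) (G.q C M) (G.v C M) := by
    ext i k
    have hik : (i : Fin d) ≠ k := fun h => Finset.disjoint_left.1 G.disjoint_q_v i.2 (h ▸ k.2)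
    simp [blk, one_apply_ne hik]
  have hV : G.testEffectV C M = blk (G.testMatrix C M) (G.observed C M) (G.v C M)
      + G.testEffectQ C M * (1 - G.testMatrix C M).submatrix (fun x : G.q C M => (x : Fin d))
        (fun x : G.v C M => (x : Fin d)) := by
    rw [testEffectV, G.testEffect_eq]
    rfl
  rw [hV, hzero, Matrix.mul_neg, neg_add_cancel_right]

theorem testEffectQ_nonneg (z : G.observed C M) (x : G.q C M) : 0 ≤ G.testEffectQ C M z x := by
  rw [G.testEffectQ_eq]
  exact ((G.posOn_testMatrix fun z : G.observed C M => z.2).mul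
    G.isMMatrix_blk_test_q.posOn_one_inv).nonneg z x

theorem one_sub_testMatrix_nonneg (hi : i ∈ G.q C M) (k : Fin d) :
    0 ≤ (1 - G.testMatrix C M) i k := by
  obtain rfl | hik := eq_or_ne i k
  · simp [G.testMatrix_apply_self]
  · rw [Matrix.sub_apply, one_apply_ne hik, zero_sub,
      G.testMatrix_apply_of_ne (G.notMem_observed_of_mem_q hi) hik]
    exact mul_nonneg (by positivity) (G.edgeMatrix_nonneg i k)

theorem testMatrix_le_testEffect (z : G.observed C M) (k : Fin d) :
    G.testMatrix C M z k ≤ G.testEffect C M z k := by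
  rw [G.testEffect_eq]
  exact le_add_of_nonneg_right (Finset.sum_nonneg fun x _ =>
    mul_nonneg (G.testEffectQ_nonneg z x) (G.one_sub_testMatrix_nonneg x.2 k))

theorem testEffectQ_mul_le_testEffect (z : G.observed C M) (x : G.q C M) (k : Fin d) :
    G.testEffectQ C M z x * (1 - G.testMatrix C M) x k ≤ G.testEffect C M z k := by
  rw [G.testEffect_eq]
  refine (Finset.single_le_sum (f := fun x : G.q C M =>
    G.testEffectQ C M z x * (1 - G.testMatrix C M) x k) (fun x _ => ?_)
    (Finset.mem_univ x)).trans (le_add_of_nonneg_left ?_)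
  · exact mul_nonneg (G.testEffectQ_nonneg z x) (G.one_sub_testMatrix_nonneg x.2 k)
  · exact (G.edgeMatrix_nonneg _ _).trans_eq (G.testMatrix_apply_of_mem z.2).symm

theorem testEffect_nonneg (z : G.observed C M) (k : Fin d) : 0 ≤ G.testEffect C M z k :=
  ((G.edgeMatrix_nonneg _ _).trans_eq (G.testMatrix_apply_of_mem z.2).symm).trans
    (G.testMatrix_le_testEffect z k)

theorem exists_edge_of_mem_foster (hr : r ∈ G.foster C) : ∃ b ∈ G.right C, G.edge b r := by
  obtain ⟨-, c, hc, hrc⟩ := G.mem_foster_iff.1 hr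
  obtain ⟨b, hcb, hbr⟩ := Relation.TransGen.tail'_iff.1 hrc
  refine ⟨b, ?_, hbr⟩
  clear hbr
  induction hcb with
  | refl => exact Finset.mem_union_left _ hc
  | tail _ hxy ih => exact G.mem_right_of_edge ih hxy

variable (M) in
/-- Every node of `q` has a child in `R`; following children leads to an observed node. -/
theorem exists_testEffect_pos (hr : r ∈ G.right C) :
    ∃ z, ∀ k, G.edgeMatrix r k ≠ 0 → 0 < G.testEffect C M z k := by
  induction r using WellFoundedLT.induction with
  | ind r ih =>
    by_cases hq : r ∈ G.q C M
    · obtain ⟨b, hb, hbr⟩ := G.exists_edge_of_mem_foster (G.q_subset_foster C M hq)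
      obtain ⟨z, hz⟩ := ih b (G.lt_of_edge _ _ hbr) hb
      have hzr : 0 < G.testEffect C M z r := hz r (G.edgeMatrix_ne_zero_iff.2 (.inr hbr))
      refine ⟨z, fun k hk => ?_⟩
      obtain rfl | hrk := eq_or_ne r k
      · exact hzr
      refine (mul_pos (a := G.testEffectQ C M z ⟨r, hq⟩) hzr ?_).trans_le
        (G.testEffectQ_mul_le_testEffect z ⟨r, hq⟩ k)
      rw [Matrix.sub_apply, one_apply_ne hrk, zero_sub,
        G.testMatrix_apply_of_ne (G.notMem_observed_of_mem_q hq) hrk]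
      exact mul_pos (by positivity) ((G.edgeMatrix_nonneg r k).lt_of_ne' hk)
    · refine ⟨⟨r, Finset.mem_sdiff.2 ⟨hr, hq⟩⟩, fun k hk => ?_⟩
      exact (((G.edgeMatrix_nonneg r k).lt_of_ne' hk).trans_eq
        (G.testMatrix_apply_of_mem (Finset.mem_sdiff.2 ⟨hr, hq⟩)).symm).trans_le
        (G.testMatrix_le_testEffect ⟨r, _⟩ k)

theorem posOn_gram_testEffect (f : κ → G.foster C) (g : l → G.foster C) :
    PosOn ((G.edgeConFF C).submatrix f g)
      (((G.testEffect C M).submatrix id fun x => (f x : Fin d))ᵀ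
        * (G.testEffect C M).submatrix id fun x => (g x : Fin d)) := by
  refine PosOn.In ⟨fun i j => Finset.sum_nonneg fun z _ =>
    mul_nonneg (G.testEffect_nonneg z _) (G.testEffect_nonneg z _), fun i j hij => ?_⟩
  obtain ⟨r, -, hr⟩ := Finset.exists_ne_zero_of_sum_ne_zero hij
  obtain ⟨z, hz⟩ := G.exists_testEffect_pos M r.2
  exact Finset.sum_pos' (fun z _ => mul_nonneg (G.testEffect_nonneg z _) (G.testEffect_nonneg z _))
    ⟨z, Finset.mem_univ z, mul_pos (hz _ (left_ne_zero_of_mul hr)) (hz _ (right_ne_zero_of_mul hr))⟩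

variable {s : ℝ}

theorem conFF_test_submatrix (hs : 0 < s) (f : κ → G.foster C) (g : l → G.foster C) :
    (G.conFF C (G.testMatrix C M) (G.testVar C M s)).submatrix f g
      = ((G.testMatrix C M).submatrix (fun x : G.q C M => (x : Fin d)) fun x => (f x : Fin d))ᵀ
          * (G.testMatrix C M).submatrix (fun x : G.q C M => (x : Fin d)) (fun x => (g x : Fin d))
        + s • (((G.testMatrix C M).submatrix (fun z : G.observed C M => (z : Fin d))
              fun x => (f x : Fin d))ᵀ
            * (G.testMatrix C M).submatrix (fun z : G.observed C M => (z : Fin d))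
              fun x => (g x : Fin d)) := by
  have hR : Function.Bijective
      (Sum.elim (incl (G.q_subset_right (M := M))) (incl Finset.sdiff_subset) :
        G.q C M ⊕ G.observed C M → G.right C) :=
    bijective_sumElim_incl _ _ Finset.disjoint_sdiff
      (Finset.union_sdiff_of_subset G.q_subset_right).superset
  rw [(G.isTriangularSystem_test hs).conFF_eq, ← submatrix_mul_add_submatrix_mul hR,
    ← Matrix.smul_mul]
  congr 2
  all_goals ext i r
  · simp [testVar, blk, incl, G.notMem_observed_of_mem_q r.2]
  · simp [testVar, blk, incl, r.2, mul_comm]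

end ParentGraph

namespace ParentGraph

variable {d : ℕ} (G : ParentGraph d) (C M : Finset (Fin d))

/-- The continuation of `Σ_{qq|vC}`, a rational function of the scale `s > 0`, to all real `s`. -/
def testSigmaQQ (s : ℝ) : Matrix (G.q C M) (G.q C M) ℝ :=
  (blk (G.testMatrix C M) (G.q C M) (G.q C M))⁻¹ * gramResolvent (G.testEffectQ C M) s
    * ((blk (G.testMatrix C M) (G.q C M) (G.q C M))⁻¹)ᵀ

/-- The continuation of `Π_{q|v.C}`, a rational function of the scale `s > 0`, to all real `s`. -/
def testPiQV (s : ℝ) : Matrix (G.q C M) (G.v C M) ℝ :=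
  (blk (G.testMatrix C M) (G.q C M) (G.q C M))⁻¹
    * (-blk (G.testMatrix C M) (G.q C M) (G.v C M)
      + (-s) • (gramResolvent (G.testEffectQ C M) s
        * ((G.testEffectQ C M)ᵀ * G.testEffectV C M)))

/-- The continuation of `s⁻¹ Σ^{vv.qO}`, a rational function of the scale `s > 0`, to all real `s`;
the factor `s⁻¹` makes it non-negative for small `s < 0`. -/
def testSigmaVV (s : ℝ) : Matrix (G.v C M) (G.v C M) ℝ :=
  (G.testEffectV C M)ᵀ * G.testEffectV C M
    + (-s) • ((G.testEffectV C M)ᵀ * G.testEffectQ C M * gramResolvent (G.testEffectQ C M) s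
      * ((G.testEffectQ C M)ᵀ * G.testEffectV C M))

variable {C M} {s : ℝ}

theorem conFF_test_qq (hs : 0 < s) :
    (G.conFF C (G.testMatrix C M) (G.testVar C M s)).submatrix (incl (G.q_subset_foster C M))
        (incl (G.q_subset_foster C M))
      = (blk (G.testMatrix C M) (G.q C M) (G.q C M))ᵀ
          * blk (G.testMatrix C M) (G.q C M) (G.q C M)
        + s • ((G.testEffectQ C M * blk (G.testMatrix C M) (G.q C M) (G.q C M))ᵀ
          * (G.testEffectQ C M * blk (G.testMatrix C M) (G.q C M) (G.q C M))) := by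
  rw [G.testEffectQ_mul]
  exact G.conFF_test_submatrix hs _ _

theorem conFF_test_qv (hs : 0 < s) :
    (G.conFF C (G.testMatrix C M) (G.testVar C M s)).submatrix (incl (G.q_subset_foster C M))
        (incl (G.v_subset_foster C M))
      = (blk (G.testMatrix C M) (G.q C M) (G.q C M))ᵀ
          * blk (G.testMatrix C M) (G.q C M) (G.v C M)
        + s • ((G.testEffectQ C M * blk (G.testMatrix C M) (G.q C M) (G.q C M))ᵀ
          * (G.testEffectV C M
            + G.testEffectQ C M * blk (G.testMatrix C M) (G.q C M) (G.v C M))) := by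
  rw [G.testEffectQ_mul, G.testEffectV_add]
  exact G.conFF_test_submatrix hs _ _

theorem conFF_test_vq (hs : 0 < s) :
    (G.conFF C (G.testMatrix C M) (G.testVar C M s)).submatrix (incl (G.v_subset_foster C M))
        (incl (G.q_subset_foster C M))
      = (blk (G.testMatrix C M) (G.q C M) (G.v C M))ᵀ
          * blk (G.testMatrix C M) (G.q C M) (G.q C M)
        + s • ((G.testEffectV C M
            + G.testEffectQ C M * blk (G.testMatrix C M) (G.q C M) (G.v C M))ᵀ
          * (G.testEffectQ C M * blk (G.testMatrix C M) (G.q C M) (G.q C M))) := by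
  rw [G.testEffectQ_mul, G.testEffectV_add]
  exact G.conFF_test_submatrix hs _ _

theorem conFF_test_vv (hs : 0 < s) :
    (G.conFF C (G.testMatrix C M) (G.testVar C M s)).submatrix (incl (G.v_subset_foster C M))
        (incl (G.v_subset_foster C M))
      = (blk (G.testMatrix C M) (G.q C M) (G.v C M))ᵀ
          * blk (G.testMatrix C M) (G.q C M) (G.v C M)
        + s • ((G.testEffectV C M
            + G.testEffectQ C M * blk (G.testMatrix C M) (G.q C M) (G.v C M))ᵀ
          * (G.testEffectV C M
            + G.testEffectQ C M * blk (G.testMatrix C M) (G.q C M) (G.v C M))) := by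
  rw [G.testEffectV_add]
  exact G.conFF_test_submatrix hs _ _

theorem sigmaQQ_test (hs : 0 < s) :
    G.sigmaQQ C M (G.testMatrix C M) (G.testVar C M s) = G.testSigmaQQ C M s := by
  rw [G.sigmaQQ_eq, G.conFF_test_qq hs, inv_gram_add_smul_gram, testSigmaQQ]

theorem piQV_test (hs : 0 < s) :
    G.piQV C M (G.testMatrix C M) (G.testVar C M s) = G.testPiQV C M s := by
  rw [G.piQV_eq, G.conFF_test_qq hs, G.conFF_test_qv hs,
    inv_gram_add_smul_gram_mul G.isMMatrix_blk_test_q.isUnit_det hs.le, testPiQV,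
    ← Matrix.mul_neg, neg_add, neg_smul]

theorem sigmaVV_test (hs : 0 < s) :
    G.sigmaVV C M (G.testMatrix C M) (G.testVar C M s) = s • G.testSigmaVV C M s := by
  rw [G.sigmaVV_eq, G.conFF_test_qq hs, G.conFF_test_qv hs, G.conFF_test_vq hs,
    G.conFF_test_vv hs, gram_add_smul_gram_schur G.isMMatrix_blk_test_q.isUnit_det hs.le,
    testSigmaVV]

theorem analyticAt_testSigmaQQ_apply (i j : G.q C M) :
    AnalyticAt ℝ (fun s => G.testSigmaQQ C M s i j) 0 := by
  have hR := analyticAt_gramResolvent_apply (G.testEffectQ C M)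
  simp only [testSigmaQQ, mul_apply]
  fun_prop

theorem analyticAt_testPiQV_apply (i : G.q C M) (j : G.v C M) :
    AnalyticAt ℝ (fun s => G.testPiQV C M s i j) 0 := by
  have hR := analyticAt_gramResolvent_apply (G.testEffectQ C M)
  simp only [testPiQV, mul_apply, Matrix.add_apply, Matrix.smul_apply, smul_eq_mul]
  fun_prop

theorem analyticAt_testSigmaVV_apply (i j : G.v C M) :
    AnalyticAt ℝ (fun s => G.testSigmaVV C M s i j) 0 := by
  have hR := analyticAt_gramResolvent_apply (G.testEffectQ C M)
  simp only [testSigmaVV, mul_apply, Matrix.add_apply, Matrix.smul_apply, smul_eq_mul]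
  fun_prop

theorem eventually_posOn_gramResolvent_test : ∀ᶠ s in 𝓝[<] (0 : ℝ),
    PosOn (walkClosure ((G.edgeConFF C).submatrix (incl (G.q_subset_foster C M))
      (incl (G.q_subset_foster C M)))) (gramResolvent (G.testEffectQ C M) s) :=
  eventually_posOn_gramResolvent (fun _ _ => In_nonneg _ _ _) (fun _ _ => In_le_one _ _ _)
    (G.posOn_gram_testEffect _ _)

theorem eventually_posOn_testSigmaQQ :
    ∀ᶠ s in 𝓝[<] (0 : ℝ), PosOn (G.edgeSqq C M) (G.testSigmaQQ C M s) := by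
  filter_upwards [G.eventually_posOn_gramResolvent_test] with s hR
  have hQ := (G.isMMatrix_blk_test_q (C := C) (M := M)).posOn_one_inv
  have hQRQ := ((hQ.mul hR).mul hQ.transpose).In
  rwa [transpose_one, Matrix.one_mul, Matrix.mul_one, ← G.edgeSqq_eq] at hQRQ

theorem eventually_posOn_testPiQV :
    ∀ᶠ s in 𝓝[<] (0 : ℝ), PosOn (G.edgePqv C M) (G.testPiQV C M s) := by
  filter_upwards [G.eventually_posOn_gramResolvent_test, self_mem_nhdsWithin] with s hR hs
  have hX : PosOn 0 (-blk (G.testMatrix C M) (G.q C M) (G.v C M)) :=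
    .of_nonneg (G.posOn_neg_testMatrix (fun x => G.notMem_observed_of_mem_q x.2)
      fun x y h => Finset.disjoint_left.1 G.disjoint_q_v x.2 (h ▸ y.2)).nonneg
  have hV := (hR.mul (G.posOn_gram_testEffect (M := M) (incl (G.q_subset_foster C M))
    (incl (G.v_subset_foster C M)))).smul (neg_pos.2 hs)
  have hQXV := (G.isMMatrix_blk_test_q.posOn_one_inv.mul (hX.add hV)).In
  rwa [zero_add, Matrix.one_mul, ← G.edgePqv_eq] at hQXV

theorem eventually_posOn_testSigmaVV :
    ∀ᶠ s in 𝓝[<] (0 : ℝ), PosOn (G.edgeSvv C M) (G.testSigmaVV C M s) := by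
  filter_upwards [G.eventually_posOn_gramResolvent_test, self_mem_nhdsWithin] with s hR hs
  rw [G.edgeSvv_eq]
  exact ((G.posOn_gram_testEffect _ _).add ((((G.posOn_gram_testEffect _ _).mul hR).mul
    (G.posOn_gram_testEffect _ _)).smul (neg_pos.2 hs))).In

end ParentGraph

/-! ### Edge matrices of the summary graph -/

namespace ParentGraph

variable {d : ℕ} (G : ParentGraph d) (C M : Finset (Fin d))

theorem structuralEdgeMatrix_eq_In {m n : Type*}
    {X : Matrix (Fin d) (Fin d) ℝ → (Fin d → ℝ) → Matrix m n ℝ} {F : Matrix m n ℝ}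
    (hsound : ∀ A δ, G.IsTriangularSystem A δ → SupportedOn (X A δ) F)
    (hcomplete : ∀ i k, F i k ≠ 0 → ∃ A δ, G.IsTriangularSystem A δ ∧ X A δ i k ≠ 0) :
    G.structuralEdgeMatrix X = In F := by
  ext i k
  have hiff : (∀ A δ, G.IsTriangularSystem A δ → X A δ i k = 0) ↔ F i k = 0 := by
    refine ⟨fun h => ?_, fun h A δ hA => (hsound A δ hA).eq_zero i k h⟩
    by_contra hF
    obtain ⟨A, δ, hA, hX⟩ := hcomplete i k hF
    exact hX (h A δ hA)
  simp only [structuralEdgeMatrix, In, of_apply, hiff]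

/-- The matrix whose indicator is the edge matrix of `u` given `v` in the summary graph. -/
def unreducedHuv : Matrix (G.u C M) (G.v C M) ℝ :=
  blk (G.edgeD C M) (G.u C M) (G.v C M) + blk (G.edgeD C M) (G.u C M) (G.q C M) * G.edgePqv C M

/-- The matrix whose indicator is the edge matrix of the residual covariances of `u` in the summary
graph. -/
def unreducedWuu : Matrix (G.u C M) (G.u C M) ℝ :=
  (1 + blk (G.edgeD C M) (G.u C M) (G.p C M) * (blk (G.edgeD C M) (G.u C M) (G.p C M))ᵀ)
    + blk (G.edgeD C M) (G.u C M) (G.q C M) * G.edgeSqq C M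
      * (blk (G.edgeD C M) (G.u C M) (G.q C M))ᵀ

section Soundness

theorem supportedOn_blk_diagonal (δ : Fin d → ℝ) (a : Finset (Fin d)) :
    SupportedOn (blk (diagonal δ) a a) 1 := by
  rw [blk, submatrix_diagonal _ _ Subtype.val_injective]
  exact .diagonal _

variable {G} {A : Matrix (Fin d) (Fin d) ℝ} {δ : Fin d → ℝ} (hA : G.IsTriangularSystem A δ)

include hA

theorem IsTriangularSystem.supportedOn_paramD : SupportedOn (G.paramD C M A) (G.edgeD C M) :=
  hA.supportedOn.partialInv _ G.edgeMatrix_le_one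

theorem IsTriangularSystem.supportedOn_conFF : SupportedOn (G.conFF C A δ) (G.edgeConFF C) := by
  rw [hA.conFF_eq]
  have hR := hA.supportedOn.submatrix (fun r : G.right C => (r : Fin d))
    fun x : G.foster C => (x : Fin d)
  have hRR := ((hR.transpose.mul (.diagonal fun r : G.right C => (δ r)⁻¹)).mul hR).In
  rwa [Matrix.mul_one] at hRR

theorem IsTriangularSystem.supportedOn_invConFF :
    SupportedOn (G.invConFF C M A δ) (G.zerConFF C M) :=
  (hA.supportedOn_conFF C).partialInv _ fun _ _ => In_le_one _ _ _

theorem IsTriangularSystem.supportedOn_paramHuv : SupportedOn (G.paramHuv C M A δ)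
    (G.unreducedHuv C M) :=
  ((hA.supportedOn_paramD C M).submatrix _ _).add
    (((hA.supportedOn_paramD C M).submatrix _ _).mul ((hA.supportedOn_invConFF C M).submatrix _ _))

theorem IsTriangularSystem.supportedOn_paramWuu : SupportedOn (G.paramWuu C M A δ)
    (G.unreducedWuu C M) := by
  have hD := hA.supportedOn_paramD C M
  have hp := (hD.submatrix (fun x : G.u C M => (x : Fin d)) fun y : G.p C M => (y : Fin d)).mul
    (supportedOn_blk_diagonal δ _)
  rw [Matrix.mul_one] at hp
  exact ((supportedOn_blk_diagonal δ _).add (hp.mul (hD.submatrix _ _).transpose)).add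
    (((hD.submatrix _ _).mul ((hA.supportedOn_invConFF C M).submatrix _ _)).mul
      (hD.submatrix _ _).transpose)

end Soundness

section Completeness

variable {s : ℝ}

theorem blk_diagonal_testVar {a : Finset (Fin d)} (ha : ∀ i ∈ a, i ∉ G.observed C M) :
    blk (diagonal (G.testVar C M s)) a a = 1 := by
  rw [blk, submatrix_diagonal _ _ Subtype.val_injective, ← diagonal_one]
  exact congrArg diagonal (funext fun x => if_neg (ha x x.2))

theorem paramWuu_test (hs : 0 < s) : G.paramWuu C M (G.testMatrix C M) (G.testVar C M s)
    = (1 + blk (G.paramD C M (G.testMatrix C M)) (G.u C M) (G.p C M)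
        * (blk (G.paramD C M (G.testMatrix C M)) (G.u C M) (G.p C M))ᵀ)
      + blk (G.paramD C M (G.testMatrix C M)) (G.u C M) (G.q C M) * G.testSigmaQQ C M s
        * (blk (G.paramD C M (G.testMatrix C M)) (G.u C M) (G.q C M))ᵀ := by
  rw [paramWuu, G.sigmaQQ_test hs,
    G.blk_diagonal_testVar C M fun i hi =>
      G.notMem_observed_of_notMem_right (G.notMem_right_of_mem_u hi),
    G.blk_diagonal_testVar C M fun i hi =>
      G.notMem_observed_of_notMem_right (G.notMem_right_of_mem_p hi), Matrix.mul_one]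

theorem posOn_neg_blk_paramD_test {b : Finset (Fin d)} (hb : b ⊆ G.right C) :
    PosOn (blk (G.edgeD C M) (G.u C M) b)
      (-blk (G.paramD C M (G.testMatrix C M)) (G.u C M) b) :=
  G.posOn_neg_paramD_test (fun i => i.2) (fun k => G.notMem_p_of_mem_right (hb k.2))
    fun i k h => G.notMem_right_of_mem_u i.2 (h ▸ hb k.2)

theorem exists_paramHuu_ne_zero {i k : G.u C M}
    (h : blk (G.edgeD C M) (G.u C M) (G.u C M) i k ≠ 0) :
    ∃ A δ, G.IsTriangularSystem A δ ∧ G.paramHuu C M A i k ≠ 0 := by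
  have hT := G.isTriangularSystem_test (C := C) (M := M) one_pos
  refine ⟨_, _, hT, ?_⟩
  obtain rfl | hik := eq_or_ne i k
  · rw [hT.isGaussianSummaryModel.diag]
    exact one_ne_zero
  · have hpos := (G.posOn_neg_paramD_test (f := fun _ : Unit => (i : Fin d))
      (g := fun _ : Unit => (k : Fin d)) (fun _ => i.2) (fun _ => G.notMem_p_of_mem_u k.2)
      fun _ _ => Subtype.coe_ne_coe.2 hik).pos () () h
    exact neg_ne_zero.1 hpos.ne'

theorem exists_paramHuv_ne_zero {i : G.u C M} {k : G.v C M}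
    (h : G.unreducedHuv C M i k ≠ 0) :
    ∃ A δ, G.IsTriangularSystem A δ ∧ G.paramHuv C M A δ i k ≠ 0 := by
  have han : AnalyticAt ℝ (fun s => (-blk (G.paramD C M (G.testMatrix C M)) (G.u C M) (G.v C M)
      + -blk (G.paramD C M (G.testMatrix C M)) (G.u C M) (G.q C M) * G.testPiQV C M s) i k) 0 := by
    have hP := G.analyticAt_testPiQV_apply (C := C) (M := M)
    simp only [Matrix.add_apply, mul_apply]
    fun_prop
  obtain ⟨s, hs, hne⟩ := exists_pos_apply_ne_zero han
    (G.eventually_posOn_testPiQV.mono fun s hP =>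
      (G.posOn_neg_blk_paramD_test C M G.v_subset_right).add
        ((G.posOn_neg_blk_paramD_test C M G.q_subset_right).mul hP)) h
  refine ⟨_, _, G.isTriangularSystem_test (C := C) (M := M) hs, ?_⟩
  rw [Matrix.neg_mul, ← neg_add] at hne
  rw [paramHuv, G.piQV_test hs]
  exact neg_ne_zero.1 hne

theorem exists_sigmaVV_ne_zero {i k : G.v C M} (h : G.edgeSvv C M i k ≠ 0) :
    ∃ A δ, G.IsTriangularSystem A δ ∧ G.sigmaVV C M A δ i k ≠ 0 := by
  obtain ⟨s, hs, hne⟩ := exists_pos_apply_ne_zero (G.analyticAt_testSigmaVV_apply i k)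
    G.eventually_posOn_testSigmaVV h
  refine ⟨_, _, G.isTriangularSystem_test (C := C) (M := M) hs, ?_⟩
  rw [G.sigmaVV_test hs]
  exact mul_ne_zero hs.ne' hne

theorem exists_paramWuu_ne_zero {i k : G.u C M}
    (h : G.unreducedWuu C M i k ≠ 0) :
    ∃ A δ, G.IsTriangularSystem A δ ∧ G.paramWuu C M A δ i k ≠ 0 := by
  set P := -blk (G.paramD C M (G.testMatrix C M)) (G.u C M) (G.p C M) with hP
  set Q := -blk (G.paramD C M (G.testMatrix C M)) (G.u C M) (G.q C M) with hQ
  have hPpos : PosOn (blk (G.edgeD C M) (G.u C M) (G.p C M)) P :=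
    G.posOn_neg_paramD_test_p fun x => x.2
  have hQpos : PosOn (blk (G.edgeD C M) (G.u C M) (G.q C M)) Q :=
    G.posOn_neg_blk_paramD_test C M G.q_subset_right
  have han : AnalyticAt ℝ
      (fun s => ((1 + P * Pᵀ) + Q * G.testSigmaQQ C M s * Qᵀ : Matrix _ _ ℝ) i k) 0 := by
    have hS := G.analyticAt_testSigmaQQ_apply (C := C) (M := M)
    simp only [Matrix.add_apply, mul_apply]
    fun_prop
  obtain ⟨s, hs, hne⟩ := exists_pos_apply_ne_zero han
    (G.eventually_posOn_testSigmaQQ.mono fun s hS =>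
      (PosOn.one.add (hPpos.mul hPpos.transpose)).add ((hQpos.mul hS).mul hQpos.transpose)) h
  refine ⟨_, _, G.isTriangularSystem_test (C := C) (M := M) hs, ?_⟩
  rw [G.paramWuu_test C M hs]
  simpa only [hP, hQ, transpose_neg, Matrix.neg_mul, Matrix.mul_neg, neg_neg] using hne

end Completeness

theorem summaryGraph_Huu :
    (G.summaryGraph C M).Huu = blk (G.edgeD C M) (G.u C M) (G.u C M) :=
  (G.structuralEdgeMatrix_eq_In (fun _ _ hA => (hA.supportedOn_paramD C M).submatrix _ _)
    fun _ _ => G.exists_paramHuu_ne_zero C M).trans (In_In _)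

theorem summaryGraph_Huv : (G.summaryGraph C M).Huv
    = In (G.unreducedHuv C M) :=
  G.structuralEdgeMatrix_eq_In (fun _ _ hA => hA.supportedOn_paramHuv C M)
    fun _ _ => G.exists_paramHuv_ne_zero C M

theorem summaryGraph_Svv : (G.summaryGraph C M).Svv = G.edgeSvv C M :=
  (G.structuralEdgeMatrix_eq_In (fun _ _ hA => (hA.supportedOn_invConFF C M).submatrix _ _)
    fun _ _ => G.exists_sigmaVV_ne_zero C M).trans (In_In _)

theorem summaryGraph_Wuu : (G.summaryGraph C M).Wuu
    = In (G.unreducedWuu C M) :=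
  G.structuralEdgeMatrix_eq_In (fun _ _ hA => hA.supportedOn_paramWuu C M)
    fun _ _ => G.exists_paramWuu_ne_zero C M

end ParentGraph

end SummaryGraph

end

theorem corollary4 {d : ℕ} (G : SummaryGraph.ParentGraph d) (C M : Finset (Fin d))
    (hCM : Disjoint C M) :
    (∀ (A : Matrix (Fin d) (Fin d) ℝ) (δ : Fin d → ℝ), G.IsTriangularSystem A δ →
      SummaryGraph.IsGaussianSummaryModel
        (SummaryGraph.condCov (SummaryGraph.cov A δ) (G.u C M) (G.v C M) C)
        (G.paramHuu C M A) (G.paramHuv C M A δ) (G.sigmaVV C M A δ) (G.paramWuu C M A δ)) ∧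
    (G.summaryGraph C M).Huu = SummaryGraph.blk (G.edgeD C M) (G.u C M) (G.u C M) ∧
    (G.summaryGraph C M).Huv = SummaryGraph.In
      (SummaryGraph.blk (G.edgeD C M) (G.u C M) (G.v C M)
        + SummaryGraph.blk (G.edgeD C M) (G.u C M) (G.q C M) * G.edgePqv C M) ∧
    (G.summaryGraph C M).Svv = G.edgeSvv C M ∧
    (G.summaryGraph C M).Wuu = SummaryGraph.In
      ((1 + SummaryGraph.blk (G.edgeD C M) (G.u C M) (G.p C M)
          * (SummaryGraph.blk (G.edgeD C M) (G.u C M) (G.p C M)).transpose)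
        + SummaryGraph.blk (G.edgeD C M) (G.u C M) (G.q C M) * G.edgeSqq C M
          * (SummaryGraph.blk (G.edgeD C M) (G.u C M) (G.q C M)).transpose) :=
  ⟨fun _ _ hA => hA.isGaussianSummaryModel, G.summaryGraph_Huu C M, G.summaryGraph_Huv C M,
    G.summaryGraph_Svv C M, G.summaryGraph_Wuu C M⟩
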